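/- For $h>0$ let $h\mathbb{Z}=\{kh : k\in\mathbb{Z}\}$. For $u\in\mathbb{C}^{h\mathbb{Z}}$ and $g\in h\mathbb{Z}$ put $$(\Delta_h u)_g=\frac{u_{g+h}-2u_g+u_{g-h}}{h^2}.$$ Let $L^2(h\mathbb{Z})$ be the space of all $u\in\mathbb{C}^{h\mathbb{Z}}$ with $\|u\|_{L^2(h\mathbb{Z})}^2=h\sum_{g\in h\mathbb{Z}}|u_g|^2<\infty$, with inner product $\langle u,v\rangle_{L^2(h\mathbb{Z})}=h\sum_{g\in h\mathbb{Z}}u_g\overline{v_g}$. For $n\in\mathbb{N}$ and $u\in L^2(h\mathbb{Z})$ define the homogeneous discrete Sobolev norm $\|u\|_{\dot H^n(h\mathbb{Z})}\ge 0$ by $$\|u\|_{\dot H^n(h\mathbb{Z})}^2=\langle(-\Delta_h)^n u,u\rangle_{L^2(h\mathbb{Z})},$$ and put $M_u=\|u\|_{\dot H^1(h\mathbb{Z})}+\|u\|_{L^2(h\mathbb{Z})}^3$. Theorem. For every integer $n\ge 1$ there exists a constant $C>0$ such that for all $h>0$ and all $\nu\in\{-1,1\}$ the following holds. If $u\in C^1(\mathbb{R};L^2(h\mathbb{Z}))$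 is a solution of the cubic discrete nonlinear Schrödinger equation $$i\,\partial_t u_g=(\Delta_h u)_g+\nu|u_g|^2u_g\qquad\text{for all } g\in h\mathbb{Z},\ t\in\mathbb{R},$$ then for all $t\in\mathbb{R}$ $$\|u(t)\|_{\dot H^n(h\mathbb{Z})}\le C\left[\|u(0)\|_{\dot H^n(h\mathbb{Z})}+M_{u(0)}^{\frac{2n+1}{3}}+|t|^{\frac{n-1}{2}}M_{u(0)}^{\frac{4n-1}{3}}\right],$$ where $|t|^{\frac{n-1}{2}}=1$ for $n=1$, also at $t=0$. -/

import Mathlib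

namespace DNLS

/-- The grid `hℤ = {k h : k ∈ ℤ}`, as an additive subgroup of `ℝ`. -/
abbrev Grid (h : ℝ) : Type := AddSubgroup.zmultiples h

/-- The step `h`, seen as a point of the grid `hℤ`. -/
def step (h : ℝ) : Grid h := ⟨h, AddSubgroup.mem_zmultiples h⟩

/-- The space `L²(hℤ)` of square summable complex sequences on the grid. Its topology is the one
of `ℓ²`; the norm of Mathlib's `lp` lacks the weight `h`, which is put back in `l2Norm`. -/
abbrev L2 (h : ℝ) : Type := lp (fun _ : Grid h => ℂ) 2

/-- The discrete second derivative `(Δ_h u)_g = (u_{g+h} - 2 u_g + u_{g-h}) / h²`. -/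
noncomputable def laplacian (h : ℝ) : (Grid h → ℂ) →ₗ[ℂ] (Grid h → ℂ) where
  toFun u g := (u (g + step h) - 2 * u g + u (g - step h)) / (h : ℂ) ^ 2
  map_add' u v := by
    funext g
    simp only [Pi.add_apply]
    ring
  map_smul' c u := by
    funext g
    simp only [Pi.smul_apply, smul_eq_mul, RingHom.id_apply]
    ring

/-- The inner product `⟨u, v⟩ = h ∑_{g ∈ hℤ} u_g conj(v_g)` of `L²(hℤ)`. -/
noncomputable def l2Inner (h : ℝ) (u v : Grid h → ℂ) : ℂ :=
  (h : ℂ) * ∑' g : Grid h, u g * (starRingEnd ℂ) (v g)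

/-- The norm `‖u‖_{L²(hℤ)} = (h ∑_{g ∈ hℤ} |u_g|²)^{1/2}`. -/
noncomputable def l2Norm (h : ℝ) (u : L2 h) : ℝ :=
  Real.sqrt (h * ∑' g : Grid h, ‖u g‖ ^ 2)

/-- The homogeneous discrete Sobolev norm of order `n`, given by
`‖u‖² = ⟨(-Δ_h)ⁿ u, u⟩_{L²(hℤ)}`. -/
noncomputable def sobolevNorm (h : ℝ) (n : ℕ) (u : L2 h) : ℝ :=
  Real.sqrt (l2Inner h (((-laplacian h) ^ n) (u : Grid h → ℂ)) (u : Grid h → ℂ)).re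

/-- `u ∈ C¹(ℝ; L²(hℤ))` is a solution of the cubic discrete nonlinear Schrödinger equation
`i ∂ₜ u_g = (Δ_h u)_g + ν |u_g|² u_g`, for all `g ∈ hℤ`. -/
structure IsSolution (h ν : ℝ) (u : ℝ → L2 h) : Prop where
  contDiff : ContDiff ℝ 1 u
  equation : ∀ (t : ℝ) (g : Grid h),
    Complex.I * deriv (fun s : ℝ => (u s) g) t
      = laplacian h (u t : Grid h → ℂ) g + (ν : ℂ) * ((‖(u t) g‖ ^ 2 : ℝ) : ℂ) * (u t) g

/-- The quantity `M_u = ‖u‖_{Ḣ¹(hℤ)} + ‖u‖_{L²(hℤ)}³`. -/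
noncomputable def lowNorm (h : ℝ) (u : L2 h) : ℝ :=
  sobolevNorm h 1 u + l2Norm h u ^ 3

end DNLS

/-! The substitution `v(τ) = h u(h² τ)` reduces everything to the lattice `ℤ` with step one: all
terms of the estimate pick up the same power of `√h`. There, conservation of mass and of the
Hamiltonian, together with `‖a‖_∞² ≤ 2 ‖a‖ ‖D a‖`, settles `n = 1` for both signs
(`IsFlow.norm_diff_le_two_mul`).

For `n ≥ 2` the proof uses a modified energy. Put `ω(θ) = 2 - 2 cos θ`, so that `ω(θ) + ω(θ + π) =
4`, and let `σ` consist of the terms with `ω(θ)` to a power at least `n` in the binomial expansion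
of `(ω(θ) + ω(θ + π))^(2n-1)`. The quadratic energy with symbol `σ` is comparable to `‖D^n u‖²`. Its
time derivative is a quartic form governed by the alternating sum of `σ` over four frequencies. A
quartic correction cancels that form provided the alternating sum of `σ` is divisible by that of
`ω`, which after clearing denominators is `-(1 + xz)(1 - xy)(1 - yz)`. The factor `1 + xz` is
special to the lattice and is the reason for the choice of `σ`: as `σ` is even and `σ(θ) + σ(θ + π)`
is constant, `σ` is a constant plus cosines of odd frequency, and each of these gives a divisible
sum (`resonance_dvd_altSum`). Since `σ` vanishes to order `2n` at zero and the divisor to order at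
most two, the quotient `Q` has only monomials of degree at least `2n - 2` in the differences
(`exists_quotient`).

Hence the correction, and the sextic derivative of the corrected energy, carry `2(n-1)` differences.
Let `N = n - 1`. Interpolation between `D u` and `D^n u`, organised by `Tame`, bounds both by the
power `(N-1)/N` of the energy, up to powers of the conserved quantities and lower order terms.
Integrating `|e'| ≲ e^((N-1)/N)` gives `‖D^n u‖² ≲ 1 + |t|^N` (`growth_of_deriv_bound`), hence the
exponent `(n-1)/2` for the norm. -/

namespace DNLS

open scoped ComplexConjugate

/-! ### Sequences on `ℤ`: shifts, differences and averages. -/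

/-- Square summable sequences on `ℤ`. -/
abbrev Seq : Type := lp (fun _ : ℤ => ℂ) 2

theorem two_toReal_pos : 0 < (2 : ENNReal).toReal := by norm_num

theorem summable_norm_sq {ι : Type*} (a : lp (fun _ : ι => ℂ) 2) :
    Summable fun k => ‖a k‖ ^ 2 := by
  simpa using (lp.memℓp a).summable two_toReal_pos

theorem norm_sq_eq_tsum {ι : Type*} (a : lp (fun _ : ι => ℂ) 2) :
    ‖a‖ ^ 2 = ∑' k, ‖a k‖ ^ 2 := by
  simpa using lp.norm_rpow_eq_tsum two_toReal_pos a

theorem memlp_two_of_summable {ι : Type*} {f : ι → ℂ} (hf : Summable fun k => ‖f k‖ ^ 2) :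
    Memℓp f 2 := memℓp_gen (by simpa using hf)

/-- Reindexing of square summable sequences along an equivalence. -/
noncomputable def reindex {ι κ : Type*} (e : ι ≃ κ) :
    lp (fun _ : κ => ℂ) 2 →ₗᵢ[ℂ] lp (fun _ : ι => ℂ) 2 where
  toFun a := ⟨fun k => a (e k), memlp_two_of_summable
    ((e.summable_iff (f := fun k => ‖a k‖ ^ 2)).2 (summable_norm_sq a))⟩
  map_add' a b := by ext k; rfl
  map_smul' c a := by ext k; rfl
  norm_map' a := by
    refine (sq_eq_sq₀ (norm_nonneg _) (norm_nonneg _)).1 ?_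
    rw [norm_sq_eq_tsum, norm_sq_eq_tsum]
    exact e.tsum_eq fun k => ‖a k‖ ^ 2

@[simp] theorem reindex_apply {ι κ : Type*} (e : ι ≃ κ) (a : lp (fun _ : κ => ℂ) 2) (k : ι) :
    reindex e a k = a (e k) := rfl

/-- The shift `(S a)_k = a_{k+1}`. -/
noncomputable def shift : Seq →L[ℂ] Seq := (reindex (Equiv.addRight (1 : ℤ))).toContinuousLinearMap

@[simp] theorem shift_apply (a : Seq) (k : ℤ) : shift a k = a (k + 1) := rfl

@[simp] theorem norm_shift (a : Seq) : ‖shift a‖ = ‖a‖ :=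
  (reindex (Equiv.addRight (1 : ℤ))).norm_map a

/-- The inverse shift `a_{k-1}`. -/
noncomputable def unshift : Seq →L[ℂ] Seq :=
  (reindex (Equiv.subRight (1 : ℤ))).toContinuousLinearMap

@[simp] theorem unshift_apply (a : Seq) (k : ℤ) : unshift a k = a (k - 1) := rfl

@[simp] theorem shift_unshift (a : Seq) : shift (unshift a) = a := by ext k; simp

@[simp] theorem unshift_shift (a : Seq) : unshift (shift a) = a := by ext k; simp

theorem shift_pow_apply (a : Seq) (n : ℕ) (k : ℤ) : (shift ^ n) a k = a (k + n) := by
  induction n generalizing k with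
  | zero => simp
  | succ n ih => rw [pow_succ', mul_apply_eq_comp, shift_apply, ih]; push_cast; ring_nf

/-- The forward difference `(D a)_k = a_{k+1} - a_k`. -/
noncomputable def diff : Seq →L[ℂ] Seq := shift - 1

/-- The forward sum `(A a)_k = a_{k+1} + a_k`. -/
noncomputable def avg : Seq →L[ℂ] Seq := shift + 1

@[simp] theorem diff_apply (a : Seq) (k : ℤ) : diff a k = a (k + 1) - a k := rfl

@[simp] theorem avg_apply (a : Seq) (k : ℤ) : avg a k = a (k + 1) + a k := rfl

theorem norm_diff_le (a : Seq) : ‖diff a‖ ≤ 2 * ‖a‖ := by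
  have : diff a = shift a - a := rfl
  rw [this]
  refine (norm_sub_le _ _).trans ?_
  rw [norm_shift]; linarith

theorem norm_avg_le (a : Seq) : ‖avg a‖ ≤ 2 * ‖a‖ := by
  have : avg a = shift a + a := rfl
  rw [this]
  refine (norm_add_le _ _).trans ?_
  rw [norm_shift]; linarith

theorem commute_shift_diff : Commute shift diff :=
  (Commute.refl shift).sub_right (Commute.one_right _)

theorem commute_avg_diff : Commute avg diff :=
  (commute_shift_diff).add_left (Commute.one_left _)

theorem commute_shift_avg : Commute shift avg :=
  (Commute.refl shift).add_right (Commute.one_right _)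

theorem apply_comm_of_commute {f g : Seq →L[ℂ] Seq} (h : Commute f g) (a : Seq) :
    f (g a) = g (f a) := DFunLike.congr_fun h.eq a

theorem norm_diff_pow_le (n : ℕ) (a : Seq) : ‖(diff ^ n) a‖ ≤ 2 ^ n * ‖a‖ := by
  induction n with
  | zero => simp
  | succ n ih =>
    rw [pow_succ', mul_apply_eq_comp]
    refine (norm_diff_le _).trans ?_
    rw [pow_succ]; linarith

theorem norm_avg_pow_le (n : ℕ) (a : Seq) : ‖(avg ^ n) a‖ ≤ 2 ^ n * ‖a‖ := by
  induction n with
  | zero => simp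
  | succ n ih =>
    rw [pow_succ', mul_apply_eq_comp]
    refine (norm_avg_le _).trans ?_
    rw [pow_succ]; linarith

/-- The parallelogram law; on the Fourier side, `ω(θ) + ω(θ + π) = 4`. -/
theorem norm_diff_sq_add_norm_avg_sq (a : Seq) : ‖diff a‖ ^ 2 + ‖avg a‖ ^ 2 = 4 * ‖a‖ ^ 2 := by
  have h := parallelogram_law_with_norm ℂ (shift a) a
  have h1 : diff a = shift a - a := rfl
  have h2 : avg a = shift a + a := rfl
  rw [h1, h2]
  rw [norm_shift] at h
  nlinarith [h]

/-! ### Products and conjugates -/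

theorem norm_apply_le (a : Seq) (k : ℤ) : ‖a k‖ ≤ ‖a‖ := lp.norm_apply_le_norm (by norm_num) a k

theorem summable_norm_mul_sq (a : Seq) {f : ℤ → ℂ} {B : ℝ} (hB : ∀ k, ‖f k‖ ≤ B) :
    Summable fun k => ‖a k * f k‖ ^ 2 := by
  refine Summable.of_nonneg_of_le (fun k => by positivity) (fun k => ?_)
    ((summable_norm_sq a).mul_left (B ^ 2))
  rw [norm_mul, mul_pow, mul_comm]
  gcongr
  exact hB k

/-- The pointwise product of two square summable sequences. -/
noncomputable def mul (a b : Seq) : Seq :=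
  ⟨fun k => a k * b k, memlp_two_of_summable (summable_norm_mul_sq a (norm_apply_le b))⟩

@[simp] theorem mul_apply (a b : Seq) (k : ℤ) : mul a b k = a k * b k := rfl

theorem mul_comm' (a b : Seq) : mul a b = mul b a := by ext k; simp [mul_comm]

theorem norm_mul_le_of_right (a b : Seq) {B : ℝ} (hB : ∀ k, ‖b k‖ ≤ B) :
    ‖mul a b‖ ≤ ‖a‖ * B := by
  have hB0 : 0 ≤ B := (norm_nonneg _).trans (hB 0)
  refine (sq_le_sq₀ (norm_nonneg _) (by positivity)).1 ?_
  rw [mul_pow, norm_sq_eq_tsum, norm_sq_eq_tsum, ← tsum_mul_right]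
  refine (summable_norm_sq _).tsum_le_tsum (fun k => ?_) ((summable_norm_sq a).mul_right _)
  rw [mul_apply, norm_mul, mul_pow]
  gcongr
  exact hB k

theorem norm_mul_le_of_left (a b : Seq) {B : ℝ} (hB : ∀ k, ‖a k‖ ≤ B) :
    ‖mul a b‖ ≤ B * ‖b‖ := by
  rw [mul_comm', mul_comm B]
  exact norm_mul_le_of_right b a hB

theorem isBoundedBilinearMap_mul : IsBoundedBilinearMap ℝ fun p : Seq × Seq => mul p.1 p.2 where
  add_left a b c := by ext k; simp [add_mul]
  smul_left r a b := by ext k; simp [mul_assoc]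
  add_right a b c := by ext k; simp [mul_add]
  smul_right r a b := by ext k; simp [mul_left_comm]
  bound := ⟨1, one_pos, fun a b => by
    rw [one_mul]; exact norm_mul_le_of_right a b (norm_apply_le b)⟩

theorem diff_mul (a b : Seq) : diff (mul a b) = mul (diff a) b + mul (shift a) (diff b) := by
  ext k; simp; ring

@[simp] theorem star_apply' (a : Seq) (k : ℤ) : (star a : Seq) k = conj (a k) := rfl

theorem shift_star (a : Seq) : shift (star a) = star (shift a) := by ext k; simp

theorem diff_star (a : Seq) : diff (star a) = star (diff a) := by ext k; simp

theorem avg_star (a : Seq) : avg (star a) = star (avg a) := by ext k; simp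

theorem diff_pow_star (n : ℕ) (a : Seq) : (diff ^ n) (star a) = star ((diff ^ n) a) := by
  induction n with
  | zero => simp
  | succ n ih => rw [pow_succ', mul_apply_eq_comp, ih, diff_star,
      mul_apply_eq_comp]

theorem shift_pow_star (n : ℕ) (a : Seq) : (shift ^ n) (star a) = star ((shift ^ n) a) := by
  induction n with
  | zero => simp
  | succ n ih => rw [pow_succ', mul_apply_eq_comp, ih, shift_star,
      mul_apply_eq_comp]

/-! ### Pairings -/

/-- The bilinear pairing `∑ a_k b_k`. -/
noncomputable def pair (a b : Seq) : ℂ := ∑' k, a k * b k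

theorem pair_eq_inner (a b : Seq) : pair a b = inner ℂ (star a) b := by
  rw [lp.inner_eq_tsum]
  simp [pair, mul_comm]

theorem inner_eq_pair (a b : Seq) : inner ℂ a b = pair (star a) b := by
  rw [pair_eq_inner, star_star]

theorem summable_pair (a b : Seq) : Summable fun k => a k * b k := by
  have := lp.summable_inner (𝕜 := ℂ) (star a) b
  simpa [mul_comm] using this

theorem norm_pair_le (a b : Seq) : ‖pair a b‖ ≤ ‖a‖ * ‖b‖ := by
  rw [pair_eq_inner]
  exact (norm_inner_le_norm _ _).trans (by rw [norm_star])

theorem isBoundedBilinearMap_pair : IsBoundedBilinearMap ℝ fun p : Seq × Seq => pair p.1 p.2 where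
  add_left a b c := by simp [pair_eq_inner]
  smul_left r a b := by
    simp only [pair, lp.coeFn_smul, Pi.smul_apply, smul_mul_assoc, tsum_const_smul'']
  add_right a b c := by simp [pair_eq_inner]
  smul_right r a b := by
    simp only [pair, lp.coeFn_smul, Pi.smul_apply, mul_smul_comm, tsum_const_smul'']
  bound := ⟨1, one_pos, fun a b => by
    rw [one_mul]; exact norm_pair_le a b⟩

theorem pair_comm (a b : Seq) : pair a b = pair b a := by simp [pair, mul_comm]

theorem pair_shift (a b : Seq) : pair (shift a) (shift b) = pair a b :=
  (Equiv.addRight (1 : ℤ)).tsum_eq fun k => a k * b k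

theorem pair_add_left (a b c : Seq) : pair (a + b) c = pair a c + pair b c :=
  isBoundedBilinearMap_pair.add_left a b c

theorem pair_add_right (a b c : Seq) : pair a (b + c) = pair a b + pair a c :=
  isBoundedBilinearMap_pair.add_right a b c

theorem pair_smul_left (r : ℂ) (a b : Seq) : pair (r • a) b = r * pair a b := by
  simp only [pair, lp.coeFn_smul, Pi.smul_apply, smul_eq_mul, mul_assoc, tsum_mul_left]

theorem pair_smul_right (r : ℂ) (a b : Seq) : pair a (r • b) = r * pair a b := by
  rw [pair_comm, pair_smul_left, pair_comm]

theorem pair_neg_left (a b : Seq) : pair (-a) b = -pair a b := by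
  simpa using pair_smul_left (-1) a b

theorem pair_neg_right (a b : Seq) : pair a (-b) = -pair a b := by
  simpa using pair_smul_right (-1) a b

theorem pair_sub_left (a b c : Seq) : pair (a - b) c = pair a c - pair b c := by
  rw [sub_eq_add_neg, pair_add_left, pair_neg_left, sub_eq_add_neg]

theorem pair_sub_right (a b c : Seq) : pair a (b - c) = pair a b - pair a c := by
  rw [sub_eq_add_neg, pair_add_right, pair_neg_right, sub_eq_add_neg]

theorem pair_star (a b : Seq) : pair (star a) (star b) = conj (pair a b) := by
  simp only [pair, star_apply', Complex.conj_tsum, map_mul]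

theorem pair_diff_left (a b : Seq) : pair (diff a) b = -pair (shift a) (diff b) := by
  have h1 : diff a = shift a - a := rfl
  have h2 : diff b = shift b - b := rfl
  rw [h1, h2, pair_sub_left, pair_sub_right, pair_shift]; ring

theorem pair_avg_left (a b : Seq) : pair (avg a) b = pair (shift a) (avg b) := by
  have h1 : avg a = shift a + a := rfl
  have h2 : avg b = shift b + b := rfl
  rw [h1, h2, pair_add_left, pair_add_right, pair_shift]; ring

theorem norm_pair_diff_pow_left_le (m : ℕ) (a b : Seq) :
    ‖pair ((diff ^ m) a) b‖ ≤ ‖a‖ * ‖(diff ^ m) b‖ := by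
  induction m generalizing a b with
  | zero => simpa using norm_pair_le a b
  | succ m ih =>
    rw [pow_succ', mul_apply_eq_comp, pair_diff_left, norm_neg,
      apply_comm_of_commute (commute_shift_diff.pow_right m)]
    refine (ih _ _).trans ?_
    rw [norm_shift, ← mul_apply_eq_comp, ← pow_succ, ← pow_succ']

/-! ### Sobolev and interpolation inequalities -/

/-- The discrete Agmon inequality: `‖a k‖²` telescopes from `k` to `+∞`, where the sequence
vanishes, and Cauchy–Schwarz bounds the sum of the increments. -/
theorem norm_sq_apply_le (a : Seq) (k : ℤ) : ‖a k‖ ^ 2 ≤ 2 * ‖a‖ * ‖diff a‖ := by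
  have hs : Summable fun j : ℤ => ‖diff a j‖ * (‖a j‖ + ‖a (j + 1)‖) := by
    have h1 := (summable_pair (star (diff a)) a).norm
    have h2 := (summable_pair (star (diff a)) (shift a)).norm
    refine (h1.add h2).congr fun j => ?_
    simp only [norm_mul, star_apply', RCLike.norm_conj, shift_apply]
    ring
  have hstep : ∀ j : ℤ, ‖a j‖ ^ 2 ≤ ‖a (j + 1)‖ ^ 2 + ‖diff a j‖ * (‖a j‖ + ‖a (j + 1)‖) := by
    intro j
    have h := norm_sub_norm_le (a j) (a (j + 1))
    rw [norm_sub_rev, ← diff_apply] at h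
    nlinarith [norm_nonneg (a j), norm_nonneg (a (j + 1))]
  have hnat : Summable fun i : ℕ => ‖diff a (k + i)‖ * (‖a (k + i)‖ + ‖a (k + i + 1)‖) :=
    hs.comp_injective (i := fun i : ℕ => k + (i : ℤ)) fun i j hij => by simpa using hij
  have hpart : ∀ m : ℕ, ‖a k‖ ^ 2 ≤ ‖a (k + m)‖ ^ 2 +
      ∑ i ∈ Finset.range m, ‖diff a (k + i)‖ * (‖a (k + i)‖ + ‖a (k + i + 1)‖) := by
    intro m
    induction m with
    | zero => simp
    | succ m ih =>
      rw [Finset.sum_range_succ]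
      have := hstep (k + m)
      push_cast
      rw [← add_assoc k]
      linarith
  have hle : ∀ m : ℕ, ‖a k‖ ^ 2 ≤ ‖a (k + m)‖ ^ 2 + 2 * ‖a‖ * ‖diff a‖ := by
    intro m
    refine (hpart m).trans (add_le_add le_rfl ?_)
    refine (hnat.sum_le_tsum _ fun i _ => by positivity).trans ?_
    refine (tsum_comp_le_tsum_of_inj hs (fun i => by positivity)
      (i := fun i : ℕ => k + (i : ℤ)) fun i j hij => by simpa using hij).trans ?_
    have hsum1 : Summable fun j => ‖diff a j‖ * ‖a j‖ := by
      simpa only [norm_mul, star_apply', RCLike.norm_conj] using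
        (summable_pair (star (diff a)) a).norm
    have hsum2 : Summable fun j => ‖diff a j‖ * ‖shift a j‖ := by
      simpa only [norm_mul, star_apply', RCLike.norm_conj] using
        (summable_pair (star (diff a)) (shift a)).norm
    have hCS : ∀ b : Seq, ∑' j, ‖diff a j‖ * ‖b j‖ ≤ ‖diff a‖ * ‖b‖ := fun b =>
      (lp.tsum_mul_le_mul_norm (p := 2) (q := 2) (by norm_num; exact Real.HolderConjugate.two_two)
        (diff a) b).2
    have h1 := hCS a
    have h2 := hCS (shift a)
    rw [norm_shift] at h2
    calc ∑' j : ℤ, ‖diff a j‖ * (‖a j‖ + ‖a (j + 1)‖)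
        = ∑' j : ℤ, (‖diff a j‖ * ‖a j‖ + ‖diff a j‖ * ‖shift a j‖) := by
          simp only [mul_add, shift_apply]
      _ = _ := hsum1.tsum_add hsum2
      _ ≤ _ := by linarith
  have hlim : Filter.Tendsto (fun m : ℕ => ‖a (k + m)‖ ^ 2 + 2 * ‖a‖ * ‖diff a‖) Filter.atTop
      (nhds (0 + 2 * ‖a‖ * ‖diff a‖)) := by
    refine Filter.Tendsto.add_const _ ?_
    exact ((summable_norm_sq a).comp_injective (i := fun i : ℕ => k + (i : ℤ))
      fun i j hij => by simpa using hij).tendsto_atTop_zero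
  simpa using ge_of_tendsto' hlim hle

/-- One summation by parts. This log-convexity in the order is what drives the interpolation. -/
theorem norm_diff_pow_sq_le (j : ℕ) (a : Seq) :
    ‖(diff ^ (j + 1)) a‖ ^ 2 ≤ ‖(diff ^ j) a‖ * ‖(diff ^ (j + 2)) a‖ := by
  have h : (‖(diff ^ (j + 1)) a‖ : ℂ) ^ 2
      = -pair (shift (star ((diff ^ j) a))) (diff ((diff ^ (j + 1)) a)) := by
    rw [← pair_diff_left]
    have : diff ((diff ^ j) a) = (diff ^ (j + 1)) a := by
      rw [pow_succ', mul_apply_eq_comp]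
    rw [diff_star, this, ← inner_eq_pair, inner_self_eq_norm_sq_to_K]
    rfl
  have h2 := norm_pair_le (shift (star ((diff ^ j) a))) (diff ((diff ^ (j + 1)) a))
  rw [← norm_neg, ← h, norm_shift, norm_star, ← mul_apply_eq_comp, ← pow_succ'] at h2
  simpa using h2

end DNLS

namespace DNLS

/-! ### Interpolation bounds and their stability under products. -/

open scoped ComplexConjugate

/-- `Tame N κ L r c f`: up to the constant `c`, the differences of `f` obey the bounds that the
differences of order `≥ r` of a sequence with `‖D^j u‖ ≤ κ^(2j+1) L^(2j-2)` obey, up to the total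
order `N`. -/
structure Tame (N : ℕ) (κ L : ℝ) (r : ℕ) (c : ℝ) (f : Seq) : Prop where
  nonneg : 0 ≤ c
  l2 : ∀ i, r + i ≤ N → ‖(diff ^ i) f‖ ≤ c * κ ^ (2 * (r + i) + 1) * L ^ (2 * (r + i) - 2)
  sup : ∀ i, r + i ≤ N → ∀ k,
    ‖(diff ^ i) f k‖ ≤ c * κ ^ (2 * (r + i) + 2) * L ^ (2 * (r + i) - 1)

namespace Tame

variable {N : ℕ} {κ L : ℝ} {r s : ℕ} {c c' : ℝ} {f g : Seq}

theorem shift (hf : Tame N κ L r c f) : Tame N κ L r c (shift f) where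
  nonneg := hf.nonneg
  l2 i hi := by
    rw [← apply_comm_of_commute (commute_shift_diff.pow_right i), norm_shift]
    exact hf.l2 i hi
  sup i hi k := by
    rw [← apply_comm_of_commute (commute_shift_diff.pow_right i), shift_apply]
    exact hf.sup i hi (k + 1)

theorem shift_pow (hf : Tame N κ L r c f) (n : ℕ) : Tame N κ L r c ((DNLS.shift ^ n) f) := by
  induction n with
  | zero => simpa using hf
  | succ n ih => rw [pow_succ', mul_apply_eq_comp]; exact ih.shift

theorem star (hf : Tame N κ L r c f) : Tame N κ L r c (star f) where
  nonneg := hf.nonneg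
  l2 i hi := by rw [diff_pow_star, norm_star]; exact hf.l2 i hi
  sup i hi k := by
    rw [diff_pow_star, star_apply', RCLike.norm_conj]; exact hf.sup i hi k

theorem diff (hf : Tame N κ L r c f) : Tame N κ L (r + 1) c (diff f) where
  nonneg := hf.nonneg
  l2 i hi := by
    rw [← mul_apply_eq_comp, ← pow_succ, add_assoc, add_comm 1]
    exact hf.l2 (i + 1) (by omega)
  sup i hi k := by
    rw [← mul_apply_eq_comp, ← pow_succ, add_assoc, add_comm 1]
    exact hf.sup (i + 1) (by omega) k

theorem diff_pow (hf : Tame N κ L r c f) (n : ℕ) :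
    Tame N κ L (r + n) c ((DNLS.diff ^ n) f) := by
  induction n with
  | zero => simpa using hf
  | succ n ih => rw [pow_succ', mul_apply_eq_comp]; exact ih.diff

/-- Here the extra difference is spent at the cost of a factor two, without raising the order `r`.
This absorbs differences beyond those needed. -/
theorem diff_same (hf : Tame N κ L r c f) : Tame N κ L r (2 * c) (DNLS.diff f) where
  nonneg := by linarith [hf.nonneg]
  l2 i hi := by
    rw [← mul_apply_eq_comp, ← pow_succ, pow_succ', mul_apply_eq_comp]
    refine (norm_diff_le _).trans ?_
    linarith [hf.l2 i hi]
  sup i hi k := by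
    rw [← mul_apply_eq_comp, ← pow_succ, pow_succ', mul_apply_eq_comp, diff_apply]
    refine (norm_sub_le _ _).trans ?_
    linarith [hf.sup i hi k, hf.sup i hi (k + 1)]

theorem diff_pow_same (hf : Tame N κ L r c f) (n : ℕ) :
    Tame N κ L r (2 ^ n * c) ((DNLS.diff ^ n) f) := by
  induction n with
  | zero => simpa using hf
  | succ n ih =>
    rw [pow_succ' DNLS.diff, mul_apply_eq_comp, pow_succ' (2 : ℝ), mul_assoc]
    exact ih.diff_same

/-- Leibniz rule by induction: each difference falls on one factor and raises its order `r` or `s`,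
so only undifferentiated products remain to be bounded. -/
theorem norm_diff_pow_mul_le (hκ : 0 < κ) (hL : 1 ≤ L) (i : ℕ) :
    ∀ {r s : ℕ} {f g : Seq}, Tame N κ L r c f → Tame N κ L s c' g → r + s + i ≤ N →
      ‖(DNLS.diff ^ i) (mul f g)‖
        ≤ 2 ^ i * (c * c' * κ ^ 2) * κ ^ (2 * (r + s + i) + 1) * L ^ (2 * (r + s + i) - 2) ∧
      ∀ k, ‖(DNLS.diff ^ i) (mul f g) k‖
        ≤ 2 ^ i * (c * c' * κ ^ 2) * κ ^ (2 * (r + s + i) + 2) * L ^ (2 * (r + s + i) - 1) := by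
  induction i with
  | zero =>
    intro r s f g hf hg hN
    have hc := hf.nonneg
    have hc' := hg.nonneg
    have hL0 : 0 ≤ L := by linarith
    have f2 := hf.l2 0 (by omega)
    have fs := hf.sup 0 (by omega)
    have g2 := hg.l2 0 (by omega)
    have gs := hg.sup 0 (by omega)
    simp only [pow_zero, add_zero, one_mul] at f2 fs g2 gs ⊢
    change ‖f‖ ≤ _ at f2
    change ‖g‖ ≤ _ at g2
    change ∀ k, ‖f k‖ ≤ _ at fs
    change ∀ k, ‖g k‖ ≤ _ at gs
    change ‖mul f g‖ ≤ _ ∧ ∀ k, ‖mul f g k‖ ≤ _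
    refine ⟨?_, fun k => ?_⟩
    -- The exponent `2 * j - 2` is truncated at `j = 0`, so a factor of order zero taken in `ℓ²` may
    -- cost two powers of `L`. The factor `f` is therefore taken in `ℓ²` only when `r ≥ 1`.
    · rcases Nat.eq_zero_or_pos r with hr | hr
      · refine (norm_mul_le_of_left f g fs).trans ?_
        refine (mul_le_mul_of_nonneg_left g2 (by positivity)).trans ?_
        subst hr
        refine le_of_eq ?_
        simp only [Nat.mul_zero, Nat.zero_sub, Nat.zero_add]
        ring
      · refine (norm_mul_le_of_right f g gs).trans ?_
        refine (mul_le_mul_of_nonneg_right f2 (by positivity)).trans ?_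
        calc _ = c * c' * κ ^ 2 * κ ^ (2 * (r + s) + 1) * L ^ (2 * r - 2 + (2 * s - 1)) := by ring
          _ ≤ _ := by
            gcongr
            omega
    · rw [mul_apply, norm_mul]
      refine (mul_le_mul (fs k) (gs k) (norm_nonneg _) (by positivity)).trans ?_
      calc _ = c * c' * κ ^ 2 * κ ^ (2 * (r + s) + 2) * L ^ (2 * r - 1 + (2 * s - 1)) := by ring
        _ ≤ _ := by
          gcongr
          omega
  | succ i ih =>
    intro r s f g hf hg hN
    have h1 := ih hf.diff hg (by omega)
    have h2 := ih hf.shift hg.diff (by omega)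
    rw [show r + 1 + s + i = r + s + (i + 1) by ring] at h1
    rw [show r + (s + 1) + i = r + s + (i + 1) by ring] at h2
    rw [pow_succ, mul_apply_eq_comp, diff_mul, map_add]
    refine ⟨(norm_add_le _ _).trans ?_, fun k => ?_⟩
    · refine (add_le_add h1.1 h2.1).trans (le_of_eq ?_)
      ring
    · refine (norm_add_le _ _).trans ((add_le_add (h1.2 k) (h2.2 k)).trans (le_of_eq ?_))
      ring

theorem mul (hκ : 0 < κ) (hL : 1 ≤ L) (hf : Tame N κ L r c f) (hg : Tame N κ L s c' g) :
    Tame N κ L (r + s) (2 ^ N * (c * c' * κ ^ 2)) (mul f g) where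
  nonneg := by have := hf.nonneg; have := hg.nonneg; positivity
  l2 i hi := by
    have := hf.nonneg
    have := hg.nonneg
    refine (norm_diff_pow_mul_le hκ hL i hf hg hi).1.trans ?_
    gcongr
    · norm_num
    · omega
  sup i hi k := by
    have := hf.nonneg
    have := hg.nonneg
    refine ((norm_diff_pow_mul_le hκ hL i hf hg hi).2 k).trans ?_
    gcongr
    · norm_num
    · omega

end Tame

/-! ### Bounds on quartic forms with `2N` differences. -/

/-- The quartic form `∑ a_k b_k c_k d_k`. -/
noncomputable def quad (a b c d : Seq) : ℂ := pair (mul a b) (mul c d)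

theorem quad_eq_tsum (a b c d : Seq) : quad a b c d = ∑' k, a k * b k * c k * d k := by
  simp only [quad, pair, mul_apply, mul_assoc]

theorem quad_swap_left (a b c d : Seq) : quad a b c d = quad b a c d := by
  rw [quad, quad, mul_comm']

theorem quad_swap_mid (a b c d : Seq) : quad a b c d = quad a c b d := by
  simp only [quad_eq_tsum]; congr 1; ext k; ring

theorem quad_eq_pair (a b c d : Seq) : quad a b c d = pair a (mul (mul b c) d) := by
  simp only [quad_eq_tsum, pair, mul_apply]; congr 1; ext k; ring

theorem norm_quad_le (a b c d : Seq) {B B' : ℝ} (hc : ∀ k, ‖c k‖ ≤ B) (hd : ∀ k, ‖d k‖ ≤ B') :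
    ‖quad a b c d‖ ≤ ‖a‖ * ‖b‖ * (B * B') := by
  have hB : 0 ≤ B := (norm_nonneg _).trans (hc 0)
  rw [quad_swap_mid, quad]
  calc _ ≤ ‖mul a c‖ * ‖mul b d‖ := norm_pair_le _ _
    _ ≤ (‖a‖ * B) * (‖b‖ * B') := by
      gcongr
      · exact norm_mul_le_of_right a c hc
      · exact norm_mul_le_of_right b d hd
    _ = _ := by ring

section QuarticBounds

variable {N : ℕ} {κ L : ℝ} {a b c d : Seq} {ca cb cc cd : ℝ}

/-- Two factors go in `ℓ²` and two in the supremum norm. The conditions `1 ≤ p` and `1 ≤ q` ensure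
that both `ℓ²` factors gain their full `L ^ (-2)`, whence the exponent `4 * N - 4`. -/
theorem Tame.norm_quad_le {p q r s : ℕ} (hκ : 0 < κ) (hL : 1 ≤ L)
    (ha : Tame N κ L p ca a) (hb : Tame N κ L q cb b) (hc : Tame N κ L r cc c)
    (hd : Tame N κ L s cd d) (hp : p ≤ N) (hq : q ≤ N) (hr : r ≤ N) (hs : s ≤ N)
    (hp1 : 1 ≤ p) (hq1 : 1 ≤ q) (hsum : p + q + r + s = 2 * N) :
    ‖quad a b c d‖ ≤ ca * cb * cc * cd * κ ^ (4 * N + 6) * L ^ (4 * N - 4) := by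
  have a2 : ‖a‖ ≤ _ := ha.l2 0 (by omega)
  have b2 : ‖b‖ ≤ _ := hb.l2 0 (by omega)
  have c2 : ∀ k, ‖c k‖ ≤ _ := hc.sup 0 (by omega)
  have d2 : ∀ k, ‖d k‖ ≤ _ := hd.sup 0 (by omega)
  simp only [add_zero] at a2 b2 c2 d2
  have := ha.nonneg
  have := hb.nonneg
  have := hc.nonneg
  have := hd.nonneg
  refine (DNLS.norm_quad_le a b c d c2 d2).trans ?_
  refine (mul_le_mul_of_nonneg_right (mul_le_mul a2 b2 (norm_nonneg _) (by positivity))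
    (by positivity)).trans ?_
  calc _ = ca * cb * cc * cd * κ ^ (2 * (p + q + r + s) + 6)
        * L ^ (2 * p - 2 + (2 * q - 2) + (2 * r - 1) + (2 * s - 1)) := by ring
    _ ≤ _ := by
      rw [hsum, show 2 * (2 * N) = 4 * N by ring]
      gcongr
      omega

/-- The `p - N` excess differences on `a` are moved by parts onto the product of the other three
factors. Both sides then carry order exactly `N`, and Cauchy–Schwarz applies. -/
theorem Tame.norm_quad_diff_pow_le_of_lt {p q r : ℕ} (hκ : 0 < κ) (hL : 1 ≤ L)
    (ha : Tame N κ L 0 ca a) (hb : Tame N κ L 0 cb b) (hc : Tame N κ L 0 cc c)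
    (hd : Tame N κ L 0 cd d) (hN : 1 ≤ N) (hsum : p + q + r = 2 * N) (hp : N < p) :
    ‖quad ((DNLS.diff ^ p) a) ((DNLS.diff ^ q) b) ((DNLS.diff ^ r) c) d‖
      ≤ 4 ^ N * (ca * cb * cc * cd) * κ ^ (4 * N + 6) * L ^ (4 * N - 4) := by
  obtain ⟨m, rfl⟩ : ∃ m, p = m + N := ⟨p - N, by omega⟩
  rw [quad_eq_pair, pow_add, mul_apply_eq_comp]
  refine (norm_pair_diff_pow_left_le _ _ _).trans ?_
  have hX := ((hb.diff_pow q).mul hκ hL (hc.diff_pow r)).mul hκ hL hd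
  have h1 := ha.l2 N (by omega)
  have h2 := hX.l2 m (by omega)
  have := ha.nonneg
  refine (mul_le_mul h1 h2 (norm_nonneg _) (by positivity)).trans (le_of_eq ?_)
  rw [show 0 + q + (0 + r) + 0 + m = N by omega, show 4 * N - 4 = 2 * N - 2 + (2 * N - 2) by omega,
    show (4 : ℝ) ^ N = 2 ^ N * 2 ^ N by rw [← mul_pow]; norm_num, zero_add]
  ring

/-- Either one order exceeds `N` and summation by parts applies, or all are at most `N`; then at
least two of them are positive, and these factors are put in `ℓ²`. -/
theorem Tame.norm_quad_diff_pow_le {p q r : ℕ} (hκ : 0 < κ) (hL : 1 ≤ L)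
    (ha : Tame N κ L 0 ca a) (hb : Tame N κ L 0 cb b) (hc : Tame N κ L 0 cc c)
    (hd : Tame N κ L 0 cd d) (hN : 1 ≤ N) (hsum : p + q + r = 2 * N) :
    ‖quad ((DNLS.diff ^ p) a) ((DNLS.diff ^ q) b) ((DNLS.diff ^ r) c) d‖
      ≤ 4 ^ N * (ca * cb * cc * cd) * κ ^ (4 * N + 6) * L ^ (4 * N - 4) := by
  have a0 := ha.nonneg
  have b0 := hb.nonneg
  have c0 := hc.nonneg
  have d0 := hd.nonneg
  have hL0 : 0 ≤ L := by linarith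
  have aux : ∀ {x : ℝ}, x ≤ ca * cb * cc * cd * κ ^ (4 * N + 6) * L ^ (4 * N - 4) →
      x ≤ 4 ^ N * (ca * cb * cc * cd) * κ ^ (4 * N + 6) * L ^ (4 * N - 4) := fun hx => by
    refine hx.trans ?_
    have h1 : (1 : ℝ) ≤ 4 ^ N := one_le_pow₀ (by norm_num)
    have h2 : 0 ≤ ca * cb * cc * cd := by positivity
    have h3 := le_mul_of_one_le_left h2 h1
    gcongr ?_ * _ * _
  have ha' := ha.diff_pow p
  have hb' := hb.diff_pow q
  have hc' := hc.diff_pow r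
  rw [zero_add] at ha' hb' hc'
  by_cases hp : N < p
  · exact Tame.norm_quad_diff_pow_le_of_lt hκ hL ha hb hc hd hN hsum hp
  by_cases hq : N < q
  · rw [quad_swap_left, mul_comm ca cb]
    exact Tame.norm_quad_diff_pow_le_of_lt hκ hL hb ha hc hd hN (by omega) hq
  by_cases hr : N < r
  · rw [quad_swap_mid, quad_swap_left, show ca * cb * cc * cd = cc * ca * cb * cd by ring]
    exact Tame.norm_quad_diff_pow_le_of_lt hκ hL hc ha hb hd hN (by omega) hr
  apply aux
  rcases Nat.eq_zero_or_pos p with hp0 | hp0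
  · rw [quad_swap_left, quad_swap_mid, show ca * cb * cc * cd = cb * cc * ca * cd by ring]
    exact hb'.norm_quad_le hκ hL hc' ha' hd (by omega) (by omega) (by omega) (by omega)
      (by omega) (by omega) (by omega)
  rcases Nat.eq_zero_or_pos q with hq0 | hq0
  · rw [quad_swap_mid, show ca * cb * cc * cd = ca * cc * cb * cd by ring]
    exact ha'.norm_quad_le hκ hL hc' hb' hd (by omega) (by omega) (by omega) (by omega)
      (by omega) (by omega) (by omega)
  exact ha'.norm_quad_le hκ hL hb' hc' hd (by omega) (by omega) (by omega) (by omega)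
      (by omega) (by omega) (by omega)

theorem Tame.norm_quad_diff_pow_le_of_le {p q r : ℕ} (hκ : 0 < κ) (hL : 1 ≤ L)
    (ha : Tame N κ L 0 ca a) (hb : Tame N κ L 0 cb b) (hc : Tame N κ L 0 cc c)
    (hd : Tame N κ L 0 cd d) (hN : 1 ≤ N) (hsum : 2 * N ≤ p + q + r) :
    ‖quad ((DNLS.diff ^ p) a) ((DNLS.diff ^ q) b) ((DNLS.diff ^ r) c) d‖
      ≤ 2 ^ (p + q + r) * 4 ^ N * (ca * cb * cc * cd) * κ ^ (4 * N + 6) * L ^ (4 * N - 4) := by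
  -- Greedy choice of exactly `2N` differences; the surplus is discarded through
  -- `Tame.diff_pow_same`.
  obtain ⟨p', q', r', hp, hq, hr, hs⟩ :
      ∃ p' q' r' : ℕ, p' ≤ p ∧ q' ≤ q ∧ r' ≤ r ∧ p' + q' + r' = 2 * N :=
    ⟨min p (2 * N), min q (2 * N - min p (2 * N)),
      2 * N - min p (2 * N) - min q (2 * N - min p (2 * N)), by omega, by omega, by omega, by omega⟩
  obtain ⟨x, rfl⟩ := Nat.exists_eq_add_of_le hp
  obtain ⟨y, rfl⟩ := Nat.exists_eq_add_of_le hq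
  obtain ⟨z, rfl⟩ := Nat.exists_eq_add_of_le hr
  have hL0 : 0 ≤ L := by linarith
  have a0 := ha.nonneg
  have b0 := hb.nonneg
  have c0 := hc.nonneg
  have d0 := hd.nonneg
  simp only [pow_add, mul_apply_eq_comp]
  simp only [← pow_add]
  refine (Tame.norm_quad_diff_pow_le hκ hL (ha.diff_pow_same x) (hb.diff_pow_same y)
    (hc.diff_pow_same z) hd hN hs).trans ?_
  calc _ = 2 ^ (x + y + z) * 4 ^ N * (ca * cb * cc * cd) * κ ^ (4 * N + 6) * L ^ (4 * N - 4) := by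
        ring
    _ ≤ _ := by
      gcongr
      · norm_num
      all_goals omega

end QuarticBounds

end DNLS

namespace DNLS

/-! ### The symbol of the modified energy. -/

open Polynomial

/-- With `z = exp(iθ)`, this is `z^(2n-1)` times the symbol of the modified energy of order `n`,
the upper half of the binomial expansion of `((2 - 2 cos θ) + (2 + 2 cos θ))^(2n-1)`. -/
noncomputable def energyPoly (n : ℕ) : ℂ[X] :=
  ∑ l ∈ Finset.Icc n (2 * n - 1), C (((2 * n - 1).choose l : ℂ) * (-1) ^ l) *
    ((X - 1) ^ (2 * l) * (X + 1) ^ (2 * (2 * n - 1 - l)))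

theorem natDegree_sq_mul_sq_le (l i : ℕ) :
    ((X - 1 : ℂ[X]) ^ (2 * l) * (X + 1) ^ (2 * i)).natDegree ≤ 2 * l + 2 * i := by
  compute_degree

theorem reflect_add_C_pow {ε : ℂ} (hε : ε ^ 2 = 1) (l : ℕ) :
    reflect (2 * l) ((X + C ε : ℂ[X]) ^ (2 * l)) = (X + C ε) ^ (2 * l) := by
  induction l with
  | zero => simp [← C_1, reflect_C, -map_one]
  | succ l ih =>
    have h2 : reflect 2 ((X + C ε : ℂ[X]) ^ 2) = (X + C ε) ^ 2 := by
      have : (X + C ε : ℂ[X]) ^ 2 = C 1 * X ^ 2 + C (2 * ε) * X ^ 1 + C 1 * X ^ 0 := by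
        rw [← hε, map_mul, map_pow, map_ofNat, ← C_pow, hε, C_1]
        have : (C ε : ℂ[X]) ^ 2 = 1 := by rw [← C_pow, hε, C_1]
        linear_combination this
      rw [this]
      simp only [reflect_add, reflect_C_mul_X_pow, revAt_le (show 2 ≤ 2 by norm_num),
        revAt_le (show 1 ≤ 2 by norm_num), revAt_le (show 0 ≤ 2 by norm_num)]
      norm_num
      ring
    rw [show 2 * (l + 1) = 2 * l + 2 by ring, pow_add,
      reflect_mul _ _ (by compute_degree) (by compute_degree), ih, h2]

theorem reflect_sub_one_pow (l : ℕ) :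
    reflect (2 * l) ((X - 1 : ℂ[X]) ^ (2 * l)) = (X - 1) ^ (2 * l) := by
  simpa [sub_eq_add_neg] using reflect_add_C_pow (ε := -1) (by norm_num) l

theorem reflect_add_one_pow (l : ℕ) :
    reflect (2 * l) ((X + 1 : ℂ[X]) ^ (2 * l)) = (X + 1) ^ (2 * l) := by
  simpa using reflect_add_C_pow (ε := 1) (by norm_num) l

theorem natDegree_energyPoly_le (n : ℕ) : (energyPoly n).natDegree ≤ 2 * (2 * n - 1) := by
  refine natDegree_sum_le_of_forall_le _ _ fun l hl => ?_
  rw [Finset.mem_Icc] at hl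
  refine (natDegree_C_mul_le _ _).trans ((natDegree_sq_mul_sq_le _ _).trans ?_)
  omega

theorem reflect_finset_sum {ι : Type*} (s : Finset ι) (f : ι → ℂ[X]) (N : ℕ) :
    reflect N (∑ i ∈ s, f i) = ∑ i ∈ s, reflect N (f i) := by
  classical
  induction s using Finset.induction_on with
  | empty => simp
  | insert a s ha ih => rw [Finset.sum_insert ha, Finset.sum_insert ha, reflect_add, ih]

/-- Palindromy says that the symbol `σ` is even in `θ`. It is inherited from the factors `(X ±
1)^(2l)`. -/
theorem reflect_energyPoly (n : ℕ) : reflect (2 * (2 * n - 1)) (energyPoly n) = energyPoly n := by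
  rw [energyPoly, reflect_finset_sum]
  refine Finset.sum_congr rfl fun l hl => ?_
  rw [Finset.mem_Icc] at hl
  rw [reflect_C_mul]
  congr 1
  have : 2 * (2 * n - 1) = 2 * l + 2 * (2 * n - 1 - l) := by omega
  rw [this, reflect_mul _ _ (by compute_degree) (by compute_degree), reflect_sub_one_pow,
    reflect_add_one_pow]

theorem coeff_energyPoly_sub (n : ℕ) {i : ℕ} (hi : i ≤ 2 * (2 * n - 1)) :
    (energyPoly n).coeff (2 * (2 * n - 1) - i) = (energyPoly n).coeff i := by
  conv_rhs => rw [← reflect_energyPoly, coeff_reflect, revAt_le hi]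

/-- This is `σ(θ) + σ(θ + π) = 4^(2n-1)`. The substitution `X ↦ -X` exchanges differences and
averages, so it turns the upper half of the binomial expansion into minus the lower half, the
exponent `2n - 1` being odd. -/
theorem energyPoly_sub_comp_neg (n : ℕ) (hn : 1 ≤ n) :
    energyPoly n - (energyPoly n).comp (-X) = C (4 ^ (2 * n - 1)) * X ^ (2 * n - 1) := by
  set J := 2 * n - 1 with hJ
  set t : ℕ → ℂ[X] := fun l => C ((J.choose l : ℂ) * (-1) ^ l) *
    ((X - 1) ^ (2 * l) * (X + 1) ^ (2 * (J - l))) with ht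
  have hodd : Odd J := ⟨n - 1, by omega⟩
  have hcomp : ∀ l ≤ J, (t l).comp (-X) = -t (J - l) := by
    intro l hl
    have h1 : (-X - 1 : ℂ[X]) ^ (2 * l) = (X + 1) ^ (2 * l) := by
      rw [show (-X - 1 : ℂ[X]) = -(X + 1) by ring, Even.neg_pow (even_two_mul l)]
    have h2 : (-X + 1 : ℂ[X]) ^ (2 * (J - l)) = (X - 1) ^ (2 * (J - l)) := by
      rw [show (-X + 1 : ℂ[X]) = -(X - 1) by ring, Even.neg_pow (even_two_mul _)]
    have h3 : ((-1 : ℂ)) ^ (J - l) = -(-1) ^ l := by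
      have : ((-1 : ℂ)) ^ (J - l) * (-1) ^ l = -1 := by
        rw [← pow_add, Nat.sub_add_cancel hl, hodd.neg_one_pow]
      have h4 : ((-1 : ℂ)) ^ l * (-1) ^ l = 1 := by rw [← mul_pow]; norm_num
      linear_combination (-1 : ℂ) ^ l * this - (-1) ^ (J - l) * h4
    simp only [ht, mul_comp, C_comp, pow_comp, sub_comp, add_comp, X_comp, one_comp, h1, h2,
      Nat.choose_symm hl, h3, Nat.sub_sub_self hl]
    simp only [mul_neg, map_neg, neg_mul, neg_neg]
    ring
  have hfull : ∑ l ∈ Finset.range (J + 1), t l = C (4 ^ J) * X ^ J := by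
    have h := add_pow (-(X - 1) ^ 2 : ℂ[X]) ((X + 1) ^ 2) J
    rw [show (-(X - 1) ^ 2 + (X + 1) ^ 2 : ℂ[X]) = C 4 * X by
      rw [map_ofNat]; ring, mul_pow, ← C_pow] at h
    rw [h]
    refine Finset.sum_congr rfl fun l _ => ?_
    simp only [ht, neg_pow ((X - 1 : ℂ[X]) ^ 2), ← pow_mul, map_mul, map_natCast, map_pow, map_neg,
      map_one]
    ring
  have hsub : (energyPoly n).comp (-X) = -∑ l ∈ Finset.range n, t l := by
    have : energyPoly n = ∑ l ∈ Finset.Icc n J, t l := rfl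
    rw [this, sum_comp, ← Finset.sum_neg_distrib]
    refine Finset.sum_nbij' (fun l => J - l) (fun l => J - l) ?_ ?_ ?_ ?_ ?_
    · intro l hl; rw [Finset.mem_Icc] at hl; rw [Finset.mem_range]; omega
    · intro l hl; rw [Finset.mem_range] at hl; rw [Finset.mem_Icc]; omega
    · intro l hl; rw [Finset.mem_Icc] at hl; omega
    · intro l hl; rw [Finset.mem_range] at hl; omega
    · intro l hl; rw [Finset.mem_Icc] at hl; exact hcomp l hl.2
  rw [hsub, sub_neg_eq_add, ← hfull]
  have hIcc : energyPoly n = ∑ l ∈ Finset.Ico n (J + 1), t l := by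
    have : energyPoly n = ∑ l ∈ Finset.Icc n J, t l := rfl
    rw [this]; rfl
  rw [hIcc, add_comm, Finset.sum_range_add_sum_Ico _ (by omega)]

/-- Since the central exponent `2n - 1` is odd, this leaves in `σ` only a constant and odd
frequencies. -/
theorem coeff_energyPoly_of_odd (n : ℕ) (hn : 1 ≤ n) {i : ℕ} (hi : Odd i) (hne : i ≠ 2 * n - 1) :
    (energyPoly n).coeff i = 0 := by
  have h := congrArg (fun p => p.coeff i) (energyPoly_sub_comp_neg n hn)
  simp only [coeff_sub, coeff_C_mul, coeff_X_pow, if_neg hne, mul_zero] at h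
  rw [show (-X : ℂ[X]) = C (-1) * X by simp, comp_C_mul_X_coeff, hi.neg_one_pow] at h
  linear_combination h / 2

theorem sub_one_pow_dvd_energyPoly (n : ℕ) : (X - 1) ^ (2 * n) ∣ energyPoly n := by
  refine Finset.dvd_sum fun l hl => ?_
  rw [Finset.mem_Icc] at hl
  exact Dvd.dvd.mul_left (Dvd.dvd.mul_right (pow_dvd_pow _ (by omega)) _) _

/-! ### Divisibility by the resonance function. -/

section Resonance

variable {R : Type*} [CommRing R] [Algebra ℂ R]

/-- The alternating sum of the values of the symbol `z^(-J) p(z)` at `x, z, y, 1/(xyz)`, times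
`(xyz)^J`. -/
noncomputable def altSum (J : ℕ) (x y z : R) (p : ℂ[X]) : R :=
  (y * z) ^ J * aeval x p + (x * y) ^ J * aeval z p - (x * z) ^ J * aeval y p
    - aeval (x * y * z) p

theorem altSum_eq_sum (J : ℕ) (x y z : R) (p : ℂ[X]) {m : ℕ} (hp : p.natDegree < m) :
    altSum J x y z p = ∑ i ∈ Finset.range m, algebraMap ℂ R (p.coeff i) *
      ((y * z) ^ J * x ^ i + (x * y) ^ J * z ^ i - (x * z) ^ J * y ^ i - (x * y * z) ^ i) := by
  simp only [altSum, aeval_eq_sum_range' hp, Finset.mul_sum, ← Finset.sum_add_distrib,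
    ← Finset.sum_sub_distrib, Algebra.smul_def]
  refine Finset.sum_congr rfl fun i _ => ?_
  ring

-- With `k = J - i`, the sum equals `-(xyz)^i (1 + (xz)^k)(1 - (xy)^k)(1 - (yz)^k)`. Oddness of `k`
-- is needed only for the first factor, `1 + xz ∣ 1 + (xz)^k`.
omit [Algebra ℂ R] in
theorem resonance_dvd_of_even (J : ℕ) (hJ : Odd J) (x y z : R) {i : ℕ} (hi : Even i)
    (hle : i ≤ J) :
    (1 + x * z) * (1 - x * y) * (1 - y * z) ∣
      ((y * z) ^ J * x ^ i + (x * y) ^ J * z ^ i - (x * z) ^ J * y ^ i - (x * y * z) ^ i) +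
      ((y * z) ^ J * x ^ (2 * J - i) + (x * y) ^ J * z ^ (2 * J - i)
        - (x * z) ^ J * y ^ (2 * J - i) - (x * y * z) ^ (2 * J - i)) := by
  obtain ⟨k, rfl⟩ := Nat.exists_eq_add_of_le hle
  have hk : Odd k := by
    rcases Nat.even_or_odd k with h | h
    · exact absurd (hi.add h) (Nat.not_even_iff_odd.2 hJ)
    · exact h
  have h1 : 1 + x * z ∣ 1 + (x * z) ^ k := by
    simpa using Odd.add_dvd_pow_add_pow (1 : R) (x * z) hk
  have h2 : 1 - x * y ∣ 1 - (x * y) ^ k := by simpa using sub_dvd_pow_sub_pow (1 : R) (x * y) k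
  have h3 : 1 - y * z ∣ 1 - (y * z) ^ k := by simpa using sub_dvd_pow_sub_pow (1 : R) (y * z) k
  refine (mul_dvd_mul (mul_dvd_mul h1 h2) h3).trans ⟨-(x * y * z) ^ i, ?_⟩
  rw [show 2 * (i + k) - i = i + k + k by omega]
  ring

theorem resonance_dvd_altSum (n : ℕ) (hn : 1 ≤ n) (x y z : R) :
    (1 + x * z) * (1 - x * y) * (1 - y * z) ∣ altSum (2 * n - 1) x y z (energyPoly n) := by
  set J := 2 * n - 1 with hJ
  have hodd : Odd J := ⟨n - 1, by omega⟩
  set F : ℕ → R := fun i =>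
    (y * z) ^ J * x ^ i + (x * y) ^ J * z ^ i - (x * z) ^ J * y ^ i - (x * y * z) ^ i with hF
  have hsum : altSum J x y z (energyPoly n)
      = ∑ i ∈ Finset.range (2 * J + 1), algebraMap ℂ R ((energyPoly n).coeff i) * F i :=
    altSum_eq_sum J x y z _ (Nat.lt_succ_of_le (natDegree_energyPoly_le n))
  have hsum' : altSum J x y z (energyPoly n)
      = ∑ i ∈ Finset.range (2 * J + 1), algebraMap ℂ R ((energyPoly n).coeff i) * F (2 * J - i) := by
    rw [hsum, ← Finset.sum_range_reflect]
    refine Finset.sum_congr rfl fun i hi => ?_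
    rw [Finset.mem_range] at hi
    rw [show 2 * J + 1 - 1 - i = 2 * J - i by omega, hJ, coeff_energyPoly_sub n (by omega)]
  -- Averaging over `i ↔ 2J - i` pairs each frequency with its opposite; only the paired sums are
  -- divisible.
  have htwo : altSum J x y z (energyPoly n) = algebraMap ℂ R (1 / 2) *
      ∑ i ∈ Finset.range (2 * J + 1),
        algebraMap ℂ R ((energyPoly n).coeff i) * (F i + F (2 * J - i)) := by
    simp only [mul_add, Finset.sum_add_distrib]
    rw [← hsum, ← hsum']
    have : algebraMap ℂ R (1 / 2) * 2 = 1 := by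
      rw [← map_ofNat (algebraMap ℂ R) 2, ← map_mul]; simp
    linear_combination -(altSum J x y z (energyPoly n)) * this
  rw [htwo]
  refine Dvd.dvd.mul_left (Finset.dvd_sum fun i hi => ?_) _
  rw [Finset.mem_range] at hi
  rcases eq_or_ne i J with rfl | hne
  -- The constant part of `σ` cancels, as it occurs twice with each sign.
  · have : F J + F (2 * J - J) = 0 := by
      rw [show 2 * J - J = J by omega]; simp only [hF]; ring
    rw [this, mul_zero]; exact dvd_zero _
  rcases Nat.even_or_odd i with he | ho
  · refine Dvd.dvd.mul_left ?_ _
    rcases le_total i J with hle | hle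
    · exact resonance_dvd_of_even J hodd x y z he hle
    · have h := resonance_dvd_of_even J hodd x y z (i := 2 * J - i)
        (by rw [Nat.even_sub (by omega)]; simp [he]) (by omega)
      rw [show 2 * J - (2 * J - i) = i by omega] at h
      simp only [hF]
      rw [add_comm ((y * z) ^ J * x ^ i + _ - _ - _)]
      exact h
  · rw [coeff_energyPoly_of_odd n hn ho hne, map_zero, zero_mul]; exact dvd_zero _

end Resonance

/-! ### The vanishing order of the quotient at zero frequency. -/

section Order

open MvPolynomial

theorem le_order_mul_left {σ : Type*} {f g : MvPowerSeries σ ℂ} {m : ℕ∞} (h : m ≤ f.order) :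
    m ≤ (f * g).order := by
  rw [MvPowerSeries.order_mul]; exact h.trans le_self_add

/-- The shift variables. -/
noncomputable def var (i : Fin 3) : MvPolynomial (Fin 3) ℂ := 1 + MvPolynomial.X i

theorem le_order_aeval_energyPoly (n : ℕ) {x : MvPolynomial (Fin 3) ℂ}
    (hx : MvPolynomial.constantCoeff x = 1) :
    (2 * n : ℕ) ≤ ((Polynomial.aeval x (energyPoly n) : MvPolynomial (Fin 3) ℂ) :
      MvPowerSeries (Fin 3) ℂ).order := by
  obtain ⟨q, hq⟩ := sub_one_pow_dvd_energyPoly n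
  rw [hq, map_mul, map_pow, map_sub, Polynomial.aeval_X, map_one, MvPolynomial.coe_mul,
    MvPolynomial.coe_pow]
  refine le_order_mul_left (MvPowerSeries.le_order_pow_of_constantCoeff_eq_zero _ ?_)
  rw [← MvPowerSeries.coeff_zero_eq_constantCoeff, MvPolynomial.coeff_coe,
    ← MvPolynomial.constantCoeff_eq, map_sub, hx, map_one, sub_self]

/-- The linear coefficient at `X i` is `-1`. Hence division by such a factor lowers the order by at
most one. -/
theorem order_one_sub_var_mul_var_le {i j : Fin 3} (hij : i ≠ j) :
    ((1 - var i * var j : MvPolynomial (Fin 3) ℂ) : MvPowerSeries (Fin 3) ℂ).order ≤ 1 := by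
  have h : MvPowerSeries.coeff (Finsupp.single i 1)
      ((1 - var i * var j : MvPolynomial (Fin 3) ℂ) : MvPowerSeries (Fin 3) ℂ) ≠ 0 := by
    rw [MvPolynomial.coeff_coe]
    have e : (1 - var i * var j : MvPolynomial (Fin 3) ℂ) = -(X i + X j + X i * X j) := by
      simp only [var]; ring
    have h1 : MvPolynomial.coeff (Finsupp.single i 1) (X j : MvPolynomial (Fin 3) ℂ) = 0 := by
      rw [MvPolynomial.coeff_X, if_neg]
      intro h
      exact hij ((Finsupp.single_left_injective one_ne_zero h).symm)
    have h2 : MvPolynomial.coeff (Finsupp.single i 1) (X i * X j : MvPolynomial (Fin 3) ℂ) = 0 := by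
      rw [mul_comm, MvPolynomial.coeff_mul_X']
      simp only [MvPolynomial.coeff_X]
      rw [if_pos (by simp)]
      simp
    rw [e, MvPolynomial.coeff_neg, MvPolynomial.coeff_add, MvPolynomial.coeff_add, h1, h2]
    simp
  refine (MvPowerSeries.order_le h).trans ?_
  simp

theorem order_one_add_var_mul_var (i j : Fin 3) :
    ((1 + var i * var j : MvPolynomial (Fin 3) ℂ) : MvPowerSeries (Fin 3) ℂ).order = 0 := by
  by_contra h
  rw [← ne_eq, MvPowerSeries.order_ne_zero_iff_constCoeff_eq_zero,
    ← MvPowerSeries.coeff_zero_eq_constantCoeff, MvPolynomial.coeff_coe,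
    ← MvPolynomial.constantCoeff_eq] at h
  simp [var] at h

/-- The multiplier of the quartic correction of the modified energy exists and has no monomials of
degree less than `2n - 2`. -/
theorem exists_quotient (n : ℕ) (hn : 1 ≤ n) :
    ∃ Q : MvPolynomial (Fin 3) ℂ,
      altSum (2 * n - 1) (var 0) (var 1) (var 2) (energyPoly n)
        = Q * ((1 + var 0 * var 2) * (1 - var 0 * var 1) * (1 - var 1 * var 2)) ∧
      ∀ α ∈ Q.support, 2 * (n - 1) ≤ α.degree := by
  obtain ⟨Q, hQ⟩ := resonance_dvd_altSum n hn (var 0) (var 1) (var 2)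
  refine ⟨Q, by rw [hQ]; ring, fun α hα => ?_⟩
  have hc : ∀ i, MvPolynomial.constantCoeff (var i) = 1 := fun i => by simp [var]
  have hG : (2 * n : ℕ) ≤ ((altSum (2 * n - 1) (var 0) (var 1) (var 2) (energyPoly n) :
      MvPolynomial (Fin 3) ℂ) : MvPowerSeries (Fin 3) ℂ).order := by
    have key : ∀ (m x : MvPolynomial (Fin 3) ℂ), MvPolynomial.constantCoeff x = 1 →
        (2 * n : ℕ) ≤ ((m * Polynomial.aeval x (energyPoly n) : MvPolynomial (Fin 3) ℂ) :
          MvPowerSeries (Fin 3) ℂ).order := fun m x hx => by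
      rw [mul_comm m, MvPolynomial.coe_mul]
      exact le_order_mul_left (le_order_aeval_energyPoly n hx)
    have hadd : ∀ {p q : MvPolynomial (Fin 3) ℂ},
        (2 * n : ℕ) ≤ (p : MvPowerSeries (Fin 3) ℂ).order →
        (2 * n : ℕ) ≤ (q : MvPowerSeries (Fin 3) ℂ).order →
        (2 * n : ℕ) ≤ ((p + q : MvPolynomial (Fin 3) ℂ) : MvPowerSeries (Fin 3) ℂ).order := by
      intro p q hp hq
      rw [MvPolynomial.coe_add]
      exact (le_min hp hq).trans MvPowerSeries.min_order_le_add
    have e : altSum (2 * n - 1) (var 0) (var 1) (var 2) (energyPoly n)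
        = (var 1 * var 2) ^ (2 * n - 1) * Polynomial.aeval (var 0) (energyPoly n)
          + (var 0 * var 1) ^ (2 * n - 1) * Polynomial.aeval (var 2) (energyPoly n)
          + (-(var 0 * var 2) ^ (2 * n - 1)) * Polynomial.aeval (var 1) (energyPoly n)
          + (-1) * Polynomial.aeval (var 0 * var 1 * var 2) (energyPoly n) := by
      simp only [altSum]; ring
    rw [e]
    exact hadd (hadd (hadd (key _ _ (hc 0)) (key _ _ (hc 2))) (key _ _ (hc 1)))
      (key _ _ (by simp [hc]))
  rw [hQ] at hG
  -- Orders add over a domain, so `2n ≤ ord Q + 0 + 1 + 1`; the factor `1 + xz` is harmless, its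
  -- constant term being `2`.
  simp only [MvPolynomial.coe_mul, MvPowerSeries.order_mul] at hG
  rw [order_one_add_var_mul_var, zero_add] at hG
  have h1 := order_one_sub_var_mul_var_le (i := 0) (j := 1) (by decide)
  have h2 := order_one_sub_var_mul_var_le (i := 1) (j := 2) (by decide)
  have h3 : (Q : MvPowerSeries (Fin 3) ℂ).order ≤ (α.degree : ℕ) :=
    MvPowerSeries.order_le (by rwa [MvPolynomial.coeff_coe, ← MvPolynomial.mem_support_iff])
  have h4 : ((2 * n : ℕ) : ℕ∞) ≤ ((1 + 1 + α.degree : ℕ) : ℕ∞) := by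
    push_cast at hG ⊢
    exact hG.trans (add_le_add (add_le_add h1 h2) h3)
  have h5 := Nat.cast_le.1 h4
  omega

end Order

end DNLS

namespace DNLS

open scoped ComplexConjugate

/-! ### Quartic forms with multipliers -/

theorem mul_add_left (a a' b : Seq) : mul (a + a') b = mul a b + mul a' b :=
  isBoundedBilinearMap_mul.add_left a a' b

theorem mul_smul_left (r : ℂ) (a b : Seq) : mul (r • a) b = r • mul a b := by
  ext k; simp [mul_assoc]

theorem mul_star (a b : Seq) : mul (star a) (star b) = star (mul a b) := by ext k; simp

theorem quad_add (a a' b c d : Seq) : quad (a + a') b c d = quad a b c d + quad a' b c d := by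
  rw [quad, mul_add_left, pair_add_left]; rfl

theorem quad_smul (r : ℂ) (a b c d : Seq) : quad (r • a) b c d = r * quad a b c d := by
  rw [quad, mul_smul_left, pair_smul_left]; rfl

theorem quad_star (a b c d : Seq) :
    quad (star a) (star b) (star c) (star d) = conj (quad a b c d) := by
  rw [quad, mul_star, mul_star, pair_star]; rfl

theorem shift_mul (a b : Seq) : shift (mul a b) = mul (shift a) (shift b) := by ext k; simp

theorem shift_pow_mul (n : ℕ) (a b : Seq) :
    (shift ^ n) (mul a b) = mul ((shift ^ n) a) ((shift ^ n) b) := by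
  ext k; simp only [shift_pow_apply, mul_apply]

theorem quad_shift (a b c d : Seq) :
    quad (shift a) (shift b) (shift c) (shift d) = quad a b c d := by
  rw [quad, ← shift_mul, ← shift_mul, pair_shift]; rfl

theorem quad_shift_pow (n : ℕ) (a b c d : Seq) :
    quad ((shift ^ n) a) ((shift ^ n) b) ((shift ^ n) c) ((shift ^ n) d) = quad a b c d := by
  induction n with
  | zero => simp
  | succ n ih => simp only [pow_succ', mul_apply_eq_comp, quad_shift, ih]

theorem quad_rotate (a b c d : Seq) : quad a b c d = quad d a b c := by
  simp only [quad_eq_tsum]; congr 1; ext k; ring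

/-- The quartic form with multiplier, in which the variable `X i` acts as the difference operator
on the `i`-th argument. -/
noncomputable def quadForm (a b c d : Seq) : MvPolynomial (Fin 3) ℂ →ₗ[ℂ] ℂ :=
  (MvPolynomial.basisMonomials (Fin 3) ℂ).constr ℂ
    fun α => quad ((diff ^ α 0) a) ((diff ^ α 1) b) ((diff ^ α 2) c) d

theorem quadForm_monomial (a b c d : Seq) (α : Fin 3 →₀ ℕ) (r : ℂ) :
    quadForm a b c d (MvPolynomial.monomial α r)
      = r * quad ((diff ^ α 0) a) ((diff ^ α 1) b) ((diff ^ α 2) c) d := by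
  have : MvPolynomial.monomial α r = r • MvPolynomial.basisMonomials (Fin 3) ℂ α := by
    simp [MvPolynomial.smul_monomial]
  rw [this, map_smul, quadForm, Module.Basis.constr_basis, smul_eq_mul]

theorem quadForm_apply (a b c d : Seq) (f : MvPolynomial (Fin 3) ℂ) :
    quadForm a b c d f = ∑ α ∈ f.support,
      f.coeff α * quad ((diff ^ α 0) a) ((diff ^ α 1) b) ((diff ^ α 2) c) d := by
  conv_lhs => rw [← MvPolynomial.support_sum_monomial_coeff f, map_sum]
  simp only [quadForm_monomial]

theorem quadForm_one (a b c d : Seq) : quadForm a b c d 1 = quad a b c d := by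
  have := quadForm_monomial a b c d 0 1
  simpa using this

theorem quadForm_add₀ (a a' b c d : Seq) (f : MvPolynomial (Fin 3) ℂ) :
    quadForm (a + a') b c d f = quadForm a b c d f + quadForm a' b c d f := by
  simp only [quadForm_apply, map_add, quad_add, mul_add, Finset.sum_add_distrib]

theorem quadForm_smul₀ (r : ℂ) (a b c d : Seq) (f : MvPolynomial (Fin 3) ℂ) :
    quadForm (r • a) b c d f = r * quadForm a b c d f := by
  simp only [quadForm_apply, map_smul, quad_smul, mul_left_comm _ r, Finset.mul_sum]

theorem quadForm_add₁ (a b b' c d : Seq) (f : MvPolynomial (Fin 3) ℂ) :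
    quadForm a (b + b') c d f = quadForm a b c d f + quadForm a b' c d f := by
  simp only [quadForm_apply, quad_swap_left ((diff ^ _) a), map_add, quad_add, mul_add,
    Finset.sum_add_distrib]

theorem quadForm_smul₁ (r : ℂ) (a b c d : Seq) (f : MvPolynomial (Fin 3) ℂ) :
    quadForm a (r • b) c d f = r * quadForm a b c d f := by
  simp only [quadForm_apply, quad_swap_left ((diff ^ _) a), map_smul, quad_smul,
    mul_left_comm _ r, Finset.mul_sum]

theorem quad_swap_outer (a b c d : Seq) : quad a b c d = quad c a b d := by
  rw [quad_swap_mid, quad_swap_left]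

theorem quadForm_add₂ (a b c c' d : Seq) (f : MvPolynomial (Fin 3) ℂ) :
    quadForm a b (c + c') d f = quadForm a b c d f + quadForm a b c' d f := by
  simp only [quadForm_apply, quad_swap_outer ((diff ^ _) a), map_add, quad_add, mul_add,
    Finset.sum_add_distrib]

theorem quadForm_smul₂ (r : ℂ) (a b c d : Seq) (f : MvPolynomial (Fin 3) ℂ) :
    quadForm a b (r • c) d f = r * quadForm a b c d f := by
  simp only [quadForm_apply, quad_swap_outer ((diff ^ _) a), map_smul, quad_smul,
    mul_left_comm _ r, Finset.mul_sum]

theorem quadForm_add₃ (a b c d d' : Seq) (f : MvPolynomial (Fin 3) ℂ) :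
    quadForm a b c (d + d') f = quadForm a b c d f + quadForm a b c d' f := by
  simp only [quadForm_apply, quad_rotate ((diff ^ _) a), quad_add, mul_add,
    Finset.sum_add_distrib]

theorem quadForm_smul₃ (r : ℂ) (a b c d : Seq) (f : MvPolynomial (Fin 3) ℂ) :
    quadForm a b c (r • d) f = r * quadForm a b c d f := by
  simp only [quadForm_apply, quad_rotate ((diff ^ _) a), quad_smul,
    mul_left_comm _ r, Finset.mul_sum]

theorem quadForm_X₀_mul (a b c d : Seq) (f : MvPolynomial (Fin 3) ℂ) :
    quadForm a b c d (MvPolynomial.X 0 * f) = quadForm (diff a) b c d f := by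
  induction f using MvPolynomial.induction_on' with
  | monomial α r =>
    rw [MvPolynomial.X, MvPolynomial.monomial_mul, quadForm_monomial, quadForm_monomial]
    simp [add_comm 1, pow_succ]
  | add p q hp hq => rw [mul_add, map_add, map_add, hp, hq]

theorem quadForm_X₁_mul (a b c d : Seq) (f : MvPolynomial (Fin 3) ℂ) :
    quadForm a b c d (MvPolynomial.X 1 * f) = quadForm a (diff b) c d f := by
  induction f using MvPolynomial.induction_on' with
  | monomial α r =>
    rw [MvPolynomial.X, MvPolynomial.monomial_mul, quadForm_monomial, quadForm_monomial]
    simp [add_comm 1, pow_succ]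
  | add p q hp hq => rw [mul_add, map_add, map_add, hp, hq]

theorem quadForm_X₂_mul (a b c d : Seq) (f : MvPolynomial (Fin 3) ℂ) :
    quadForm a b c d (MvPolynomial.X 2 * f) = quadForm a b (diff c) d f := by
  induction f using MvPolynomial.induction_on' with
  | monomial α r =>
    rw [MvPolynomial.X, MvPolynomial.monomial_mul, quadForm_monomial, quadForm_monomial]
    simp [add_comm 1, pow_succ]
  | add p q hp hq => rw [mul_add, map_add, map_add, hp, hq]

theorem shift_eq_add_diff (a : Seq) : shift a = a + diff a := by ext k; simp

theorem quadForm_var₀_mul (a b c d : Seq) (f : MvPolynomial (Fin 3) ℂ) :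
    quadForm a b c d (var 0 * f) = quadForm (shift a) b c d f := by
  rw [var, add_mul, one_mul, map_add, quadForm_X₀_mul, shift_eq_add_diff, quadForm_add₀]

theorem quadForm_var₁_mul (a b c d : Seq) (f : MvPolynomial (Fin 3) ℂ) :
    quadForm a b c d (var 1 * f) = quadForm a (shift b) c d f := by
  rw [var, add_mul, one_mul, map_add, quadForm_X₁_mul, shift_eq_add_diff, quadForm_add₁]

theorem quadForm_var₂_mul (a b c d : Seq) (f : MvPolynomial (Fin 3) ℂ) :
    quadForm a b c d (var 2 * f) = quadForm a b (shift c) d f := by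
  rw [var, add_mul, one_mul, map_add, quadForm_X₂_mul, shift_eq_add_diff, quadForm_add₂]

theorem quadForm_shift (a b c d : Seq) (f : MvPolynomial (Fin 3) ℂ) :
    quadForm (shift a) (shift b) (shift c) (shift d) f = quadForm a b c d f := by
  simp only [quadForm_apply]
  refine Finset.sum_congr rfl fun α _ => ?_
  simp only [← apply_comm_of_commute (commute_shift_diff.pow_right _), quad_shift]

theorem quadForm_unshift (a b c d : Seq) (f : MvPolynomial (Fin 3) ℂ) :
    quadForm a b c (unshift d) f = quadForm a b c d (var 0 * var 1 * var 2 * f) := by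
  rw [mul_assoc, mul_assoc, quadForm_var₀_mul, quadForm_var₁_mul, quadForm_var₂_mul,
    ← quadForm_shift a b c (unshift d), shift_unshift]

theorem quadForm_var₀_pow_mul (n : ℕ) (a b c d : Seq) (f : MvPolynomial (Fin 3) ℂ) :
    quadForm a b c d (var 0 ^ n * f) = quadForm ((shift ^ n) a) b c d f := by
  induction n generalizing a with
  | zero => simp
  | succ n ih => rw [pow_succ', mul_assoc, quadForm_var₀_mul, ih, pow_succ, mul_apply_eq_comp]

theorem quadForm_var₁_pow_mul (n : ℕ) (a b c d : Seq) (f : MvPolynomial (Fin 3) ℂ) :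
    quadForm a b c d (var 1 ^ n * f) = quadForm a ((shift ^ n) b) c d f := by
  induction n generalizing b with
  | zero => simp
  | succ n ih => rw [pow_succ', mul_assoc, quadForm_var₁_mul, ih, pow_succ, mul_apply_eq_comp]

theorem quadForm_var₂_pow_mul (n : ℕ) (a b c d : Seq) (f : MvPolynomial (Fin 3) ℂ) :
    quadForm a b c d (var 2 ^ n * f) = quadForm a b ((shift ^ n) c) d f := by
  induction n generalizing c with
  | zero => simp
  | succ n ih => rw [pow_succ', mul_assoc, quadForm_var₂_mul, ih, pow_succ, mul_apply_eq_comp]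

theorem quadForm_aeval_var₀_mul (p : Polynomial ℂ) (a b c d : Seq) (f : MvPolynomial (Fin 3) ℂ) :
    quadForm a b c d (Polynomial.aeval (var 0) p * f)
      = quadForm (Polynomial.aeval shift p a) b c d f := by
  induction p using Polynomial.induction_on' with
  | add p q hp hq => simp only [map_add, add_mul, hp, hq, add_apply,
      quadForm_add₀]
  | monomial n r =>
    rw [Polynomial.aeval_monomial, Polynomial.aeval_monomial, ← Algebra.smul_def,
      ← Algebra.smul_def, smul_mul_assoc, map_smul, quadForm_var₀_pow_mul,
      smul_apply, quadForm_smul₀, smul_eq_mul]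

theorem quadForm_aeval_var₁_mul (p : Polynomial ℂ) (a b c d : Seq) (f : MvPolynomial (Fin 3) ℂ) :
    quadForm a b c d (Polynomial.aeval (var 1) p * f)
      = quadForm a (Polynomial.aeval shift p b) c d f := by
  induction p using Polynomial.induction_on' with
  | add p q hp hq => simp only [map_add, add_mul, hp, hq, add_apply,
      quadForm_add₁]
  | monomial n r =>
    rw [Polynomial.aeval_monomial, Polynomial.aeval_monomial, ← Algebra.smul_def,
      ← Algebra.smul_def, smul_mul_assoc, map_smul, quadForm_var₁_pow_mul,
      smul_apply, quadForm_smul₁, smul_eq_mul]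

theorem quadForm_aeval_var₂_mul (p : Polynomial ℂ) (a b c d : Seq) (f : MvPolynomial (Fin 3) ℂ) :
    quadForm a b c d (Polynomial.aeval (var 2) p * f)
      = quadForm a b (Polynomial.aeval shift p c) d f := by
  induction p using Polynomial.induction_on' with
  | add p q hp hq => simp only [map_add, add_mul, hp, hq, add_apply,
      quadForm_add₂]
  | monomial n r =>
    rw [Polynomial.aeval_monomial, Polynomial.aeval_monomial, ← Algebra.smul_def,
      ← Algebra.smul_def, smul_mul_assoc, map_smul, quadForm_var₂_pow_mul,
      smul_apply, quadForm_smul₂, smul_eq_mul]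

/-- Summation by parts for a palindromic polynomial in the total shift. -/
theorem quadForm_aeval_prod (p : Polynomial ℂ) (J : ℕ) (hp : p.natDegree ≤ 2 * J)
    (hpal : ∀ i ≤ 2 * J, p.coeff (2 * J - i) = p.coeff i) (a b c d : Seq) :
    quadForm a b c ((shift ^ J) d) (Polynomial.aeval (var 0 * var 1 * var 2) p)
      = quad ((shift ^ J) a) ((shift ^ J) b) ((shift ^ J) c) (Polynomial.aeval shift p d) := by
  have hR : quad ((shift ^ J) a) ((shift ^ J) b) ((shift ^ J) c) (Polynomial.aeval shift p d)
      = ∑ i ∈ Finset.range (2 * J + 1), p.coeff i *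
        quad ((shift ^ J) a) ((shift ^ J) b) ((shift ^ J) c) ((shift ^ i) d) := by
    rw [Polynomial.aeval_eq_sum_range' (Nat.lt_succ_of_le hp), sum_apply]
    simp only [quad_rotate ((shift ^ J) a), smul_apply]
    have hsum : ∀ (s : Finset ℕ) (g : ℕ → Seq) (x y z : Seq),
        quad (∑ i ∈ s, g i) x y z = ∑ i ∈ s, quad (g i) x y z := by
      intro s g x y z
      induction s using Finset.induction_on with
      | empty => simpa using quad_smul 0 0 x y z
      | insert i s hi ih => rw [Finset.sum_insert hi, Finset.sum_insert hi, quad_add, ih]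
    rw [hsum]
    simp only [quad_smul]
  rw [hR, ← Finset.sum_range_reflect, Polynomial.aeval_eq_sum_range' (Nat.lt_succ_of_le hp),
    map_sum]
  refine Finset.sum_congr rfl fun i hi => ?_
  rw [Finset.mem_range] at hi
  rw [show 2 * J + 1 - 1 - i = 2 * J - i by omega, hpal i (by omega), map_smul, smul_eq_mul]
  congr 1
  have e : (var 0 * var 1 * var 2) ^ i = var 0 ^ i * (var 1 ^ i * (var 2 ^ i * 1)) := by ring
  rw [e, quadForm_var₀_pow_mul, quadForm_var₁_pow_mul, quadForm_var₂_pow_mul, quadForm_one]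
  rcases le_total i J with h | h
  -- Translation invariance: a common shift of the first three arguments is an inverse shift of the
  -- last, and palindromy absorbs the inversion.
  · obtain ⟨k, rfl⟩ := Nat.exists_eq_add_of_le h
    rw [← quad_shift_pow k]
    simp only [← mul_apply_eq_comp, ← pow_add]
    rw [show k + i = i + k by ring, show k + (i + k) = 2 * (i + k) - i by omega]
  · obtain ⟨k, rfl⟩ := Nat.exists_eq_add_of_le h
    rw [← quad_shift_pow k ((shift ^ J) a)]
    simp only [← mul_apply_eq_comp, ← pow_add]
    rw [show k + J = J + k by ring, show k + (2 * J - (J + k)) = J by omega]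

theorem aeval_shift_star (p : Polynomial ℂ) (hp : ∀ i, conj (p.coeff i) = p.coeff i) (a : Seq) :
    Polynomial.aeval shift p (star a) = star (Polynomial.aeval shift p a) := by
  rw [Polynomial.aeval_eq_sum_range, sum_apply, sum_apply,
    star_sum]
  refine Finset.sum_congr rfl fun i _ => ?_
  rw [smul_apply, smul_apply, star_smul, shift_pow_star]
  congr 1
  exact (hp i).symm

theorem conj_coeff_energyPoly (n i : ℕ) :
    conj ((energyPoly n).coeff i) = (energyPoly n).coeff i := by
  have h : (energyPoly n).map (starRingEnd ℂ) = energyPoly n := by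
    simp [energyPoly, Polynomial.map_sum]
  conv_rhs => rw [← h, Polynomial.coeff_map]

/-- The two positive terms each equal the resonant quantity `Z`, by the symmetry between the two
copies of `u`, and the two negative terms equal `conj Z`, so the sum is `2 (Z - conj Z)`. The fourth
argument is shifted by `2n - 1` to compensate for the denominators cleared from `σ`. -/
theorem quadForm_altSum (n : ℕ) (u : Seq) :
    quadForm u (star u) u ((shift ^ (2 * n - 1)) (star u))
        (altSum (2 * n - 1) (var 0) (var 1) (var 2) (energyPoly n))
      = 4 * Complex.I * (quad (Polynomial.aeval shift (energyPoly n) u)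
          ((shift ^ (2 * n - 1)) (star u)) ((shift ^ (2 * n - 1)) u)
          ((shift ^ (2 * n - 1)) (star u))).im := by
  set J := 2 * n - 1 with hJ
  set g := energyPoly n with hg
  set Z := quad (Polynomial.aeval shift g u) ((shift ^ J) (star u)) ((shift ^ J) u)
    ((shift ^ J) (star u)) with hZ
  have hstar : Polynomial.aeval shift g (star u) = star (Polynomial.aeval shift g u) :=
    aeval_shift_star g (conj_coeff_energyPoly n) u
  have hconj : conj Z = quad (star (Polynomial.aeval shift g u)) ((shift ^ J) u)
      ((shift ^ J) (star u)) ((shift ^ J) u) := by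
    rw [hZ, ← quad_star, shift_pow_star, star_star]
  have h0 : quadForm u (star u) u ((shift ^ J) (star u))
      ((var 1 * var 2) ^ J * Polynomial.aeval (var 0) g) = Z := by
    rw [show (var 1 * var 2) ^ J * Polynomial.aeval (var 0) g
      = Polynomial.aeval (var 0) g * (var 1 ^ J * (var 2 ^ J * 1)) by ring,
      quadForm_aeval_var₀_mul, quadForm_var₁_pow_mul, quadForm_var₂_pow_mul, quadForm_one]
  have h2 : quadForm u (star u) u ((shift ^ J) (star u))
      ((var 0 * var 1) ^ J * Polynomial.aeval (var 2) g) = Z := by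
    rw [show (var 0 * var 1) ^ J * Polynomial.aeval (var 2) g
      = Polynomial.aeval (var 2) g * (var 0 ^ J * (var 1 ^ J * 1)) by ring,
      quadForm_aeval_var₂_mul, quadForm_var₀_pow_mul, quadForm_var₁_pow_mul, quadForm_one,
      quad_swap_outer, quad_swap_mid]
  have h1 : quadForm u (star u) u ((shift ^ J) (star u))
      ((var 0 * var 2) ^ J * Polynomial.aeval (var 1) g) = conj Z := by
    rw [show (var 0 * var 2) ^ J * Polynomial.aeval (var 1) g
      = Polynomial.aeval (var 1) g * (var 0 ^ J * (var 2 ^ J * 1)) by ring,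
      quadForm_aeval_var₁_mul, quadForm_var₀_pow_mul, quadForm_var₂_pow_mul, quadForm_one,
      hstar, hconj, quad_swap_left, quad_swap_mid _ _ _ ((shift ^ J) u)]
    simp only [quad_eq_tsum]; congr 1; ext k; ring
  have h3 : quadForm u (star u) u ((shift ^ J) (star u))
      (Polynomial.aeval (var 0 * var 1 * var 2) g) = conj Z := by
    rw [quadForm_aeval_prod g J (natDegree_energyPoly_le n)
      (fun i hi => coeff_energyPoly_sub n hi), hstar, hconj]
    simp only [quad_eq_tsum]; congr 1; ext k; ring
  rw [altSum, map_sub, map_sub, map_add, h0, h1, h2, h3]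
  have := Complex.sub_conj Z
  push_cast at this
  linear_combination 2 * this

/-! ### Derivatives in time -/

theorem hasDerivAt_clm (f : Seq →L[ℂ] Seq) {u : ℝ → Seq} {u' : Seq} {t : ℝ}
    (hu : HasDerivAt u u' t) : HasDerivAt (fun s => f (u s)) (f u') t :=
  (f.restrictScalars ℝ).hasFDerivAt.comp_hasDerivAt t hu

theorem hasDerivAt_mul {u v : ℝ → Seq} {u' v' : Seq} {t : ℝ}
    (hu : HasDerivAt u u' t) (hv : HasDerivAt v v' t) :
    HasDerivAt (fun s => mul (u s) (v s)) (mul (u t) v' + mul u' (v t)) t := by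
  have h : HasFDerivAt (fun p : Seq × Seq => mul p.1 p.2) _ (u t, v t) :=
    isBoundedBilinearMap_mul.hasFDerivAt (u t, v t)
  exact h.comp_hasDerivAt t (hu.prodMk hv)

theorem hasDerivAt_pair {u v : ℝ → Seq} {u' v' : Seq} {t : ℝ}
    (hu : HasDerivAt u u' t) (hv : HasDerivAt v v' t) :
    HasDerivAt (fun s => pair (u s) (v s)) (pair (u t) v' + pair u' (v t)) t := by
  have h : HasFDerivAt (fun p : Seq × Seq => pair p.1 p.2) _ (u t, v t) :=
    isBoundedBilinearMap_pair.hasFDerivAt (u t, v t)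
  exact h.comp_hasDerivAt t (hu.prodMk hv)

section FourFunctions

variable {a b c d : ℝ → Seq} {a' b' c' d' : Seq} {t : ℝ}

theorem hasDerivAt_quad (ha : HasDerivAt a a' t) (hb : HasDerivAt b b' t)
    (hc : HasDerivAt c c' t) (hd : HasDerivAt d d' t) :
    HasDerivAt (fun s => quad (a s) (b s) (c s) (d s))
      (quad a' (b t) (c t) (d t) + quad (a t) b' (c t) (d t) + quad (a t) (b t) c' (d t)
        + quad (a t) (b t) (c t) d') t := by
  refine (hasDerivAt_pair (hasDerivAt_mul ha hb) (hasDerivAt_mul hc hd)).congr_deriv ?_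
  simp only [pair_add_left, pair_add_right, quad]
  ring

theorem hasDerivAt_quadForm (ha : HasDerivAt a a' t) (hb : HasDerivAt b b' t)
    (hc : HasDerivAt c c' t) (hd : HasDerivAt d d' t) (f : MvPolynomial (Fin 3) ℂ) :
    HasDerivAt (fun s => quadForm (a s) (b s) (c s) (d s) f)
      (quadForm a' (b t) (c t) (d t) f + quadForm (a t) b' (c t) (d t) f
        + quadForm (a t) (b t) c' (d t) f + quadForm (a t) (b t) (c t) d' f) t := by
  simp only [quadForm_apply, ← Finset.sum_add_distrib, ← mul_add]
  refine HasDerivAt.fun_sum fun α _ => HasDerivAt.const_mul _ ?_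
  exact hasDerivAt_quad (hasDerivAt_clm _ ha) (hasDerivAt_clm _ hb) (hasDerivAt_clm _ hc) hd

end FourFunctions

/-! ### The bound on quartic forms -/

theorem exists_norm_quadForm_le (N : ℕ) (hN : 1 ≤ N) (Q : MvPolynomial (Fin 3) ℂ)
    (hQ : ∀ α ∈ Q.support, 2 * N ≤ α.degree) :
    ∃ K : ℝ, 0 ≤ K ∧ ∀ (κ L : ℝ), 0 < κ → 1 ≤ L → ∀ (a b c d : Seq) (ca cb cc cd : ℝ),
      Tame N κ L 0 ca a → Tame N κ L 0 cb b → Tame N κ L 0 cc c → Tame N κ L 0 cd d →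
      ‖quadForm a b c d Q‖ ≤ K * (ca * cb * cc * cd) * κ ^ (4 * N + 6) * L ^ (4 * N - 4) := by
  refine ⟨∑ α ∈ Q.support, ‖Q.coeff α‖ * (2 ^ (α 0 + α 1 + α 2) * 4 ^ N), by positivity, ?_⟩
  intro κ L hκ hL a b c d ca cb cc cd ha hb hc hd
  rw [quadForm_apply, Finset.sum_mul, Finset.sum_mul, Finset.sum_mul]
  refine norm_sum_le_of_le _ fun α hα => ?_
  have hdeg : 2 * N ≤ α 0 + α 1 + α 2 := by
    have := hQ α hα
    rwa [Finsupp.degree_eq_sum, Fin.sum_univ_three] at this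
  rw [norm_mul]
  refine (mul_le_mul_of_nonneg_left
    (Tame.norm_quad_diff_pow_le_of_le hκ hL ha hb hc hd hN hdeg) (norm_nonneg _)).trans ?_
  exact le_of_eq (by ring)

end DNLS

namespace DNLS

/-! ### The flow on `ℤ` and its conservation laws. -/

open scoped ComplexConjugate

/-- The discrete Laplacian with step one. -/
noncomputable def lap : Seq →L[ℂ] Seq := shift - 2 • (1 : Seq →L[ℂ] Seq) + unshift

theorem lap_apply (a : Seq) (k : ℤ) : lap a k = a (k + 1) - 2 * a k + a (k - 1) := by
  have : lap a = shift a - (2 : ℕ) • a + unshift a := rfl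
  rw [this, two_nsmul]
  simp [two_mul]

/-- The cubic nonlinearity `|u|² u`. -/
noncomputable def cubic (u : Seq) : Seq := mul (mul u (star u)) u

/-- Solutions on `ℤ`, with the equation read in `ℓ²`. -/
def IsFlow (ν : ℝ) (u : ℝ → Seq) : Prop :=
  ∀ t, HasDerivAt u (-Complex.I • (lap (u t) + (ν : ℂ) • cubic (u t))) t

theorem shift_lap (a : Seq) : shift (lap a) = diff (diff a) := by
  ext k; simp [lap_apply]; ring

theorem lap_star (a : Seq) : lap (star a) = star (lap a) := by
  ext k; simp [lap_apply]

theorem commute_lap_shift : Commute lap shift := by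
  ext a k; simp [lap_apply]

theorem commute_lap_diff : Commute lap diff := commute_lap_shift.sub_right (Commute.one_right _)

theorem commute_lap_avg : Commute lap avg := commute_lap_shift.add_right (Commute.one_right _)

theorem pair_lap_right (a b : Seq) : pair a (lap b) = -pair (diff a) (diff b) := by
  rw [← pair_shift, shift_lap, pair_diff_left, neg_neg]

theorem pair_lap_left (a b : Seq) : pair (lap a) b = pair a (lap b) := by
  rw [pair_comm, pair_lap_right, pair_lap_right, pair_comm]

theorem pair_star_self (a : Seq) : pair (star a) a = (‖a‖ ^ 2 : ℝ) := by
  rw [← inner_eq_pair, inner_self_eq_norm_sq_to_K]; simp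

theorem pair_star_lap_self (a : Seq) : pair (star a) (lap a) = (-‖diff a‖ ^ 2 : ℝ) := by
  rw [pair_lap_right, diff_star, pair_star_self]; push_cast; ring

theorem pair_cubic (a b : Seq) : pair b (cubic a) = quad b a (star a) a := by
  rw [quad_eq_pair, cubic]

theorem hasDerivAt_norm_sq {u : ℝ → Seq} {u' : Seq} {t : ℝ} (hu : HasDerivAt u u' t) :
    HasDerivAt (fun s => ‖u s‖ ^ 2) (2 * (pair (star (u t)) u').re) t := by
  have h := hasDerivAt_pair hu.star hu
  simp only [pair_star_self] at h
  have h2 := Complex.reCLM.hasFDerivAt.comp_hasDerivAt t h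
  refine (h2.congr_deriv ?_)
  have : pair (star u') (u t) = conj (pair (star (u t)) u') := by
    rw [← pair_star, star_star, pair_comm]
  rw [this]
  simp
  ring

theorem quad_self_eq (a : Seq) : quad a (star a) a (star a) = ((∑' k, ‖a k‖ ^ 4 : ℝ) : ℂ) := by
  rw [quad_eq_tsum, Complex.ofReal_tsum]
  congr 1; ext k
  rw [star_apply', mul_assoc (a k * conj (a k)), Complex.mul_conj, Complex.normSq_eq_norm_sq]
  push_cast; ring

theorem pair_star_cubic_self (a : Seq) :
    pair (star a) (cubic a) = ((∑' k, ‖a k‖ ^ 4 : ℝ) : ℂ) := by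
  rw [← quad_self_eq, pair_cubic]
  simp only [quad_eq_tsum]; congr 1; ext k; ring

namespace IsFlow

variable {ν : ℝ} {u : ℝ → Seq}

theorem norm_eq (hu : IsFlow ν u) (t : ℝ) : ‖u t‖ = ‖u 0‖ := by
  have hderiv : ∀ t, HasDerivAt (fun s => ‖u s‖ ^ 2) 0 t := by
    intro t
    refine (hasDerivAt_norm_sq (hu t)).congr_deriv ?_
    rw [pair_smul_right, pair_add_right, pair_smul_right, pair_star_lap_self, pair_star_cubic_self,
      ← Complex.ofReal_mul, ← Complex.ofReal_add, neg_mul, Complex.neg_re, Complex.mul_re,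
      Complex.ofReal_im, Complex.I_re]
    ring
  have h := is_const_of_deriv_eq_zero (fun t => (hderiv t).differentiableAt)
    (fun t => (hderiv t).deriv) t 0
  exact (sq_eq_sq₀ (norm_nonneg _) (norm_nonneg _)).1 h

/-- The Hamiltonian. -/
noncomputable def hamiltonian (ν : ℝ) (a : Seq) : ℝ :=
  ‖diff a‖ ^ 2 - ν / 2 * (quad a (star a) a (star a)).re

theorem hamiltonian_eq (hu : IsFlow ν u) (t : ℝ) :
    hamiltonian ν (u t) = hamiltonian ν (u 0) := by
  have hderiv : ∀ t, HasDerivAt (fun s => hamiltonian ν (u s)) 0 t := by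
    intro t
    set X := lap (u t) + (ν : ℂ) • cubic (u t) with hX
    set u' := -Complex.I • X with hu'
    have h0 : HasDerivAt u u' t := hu t
    have h1 := hasDerivAt_norm_sq (hasDerivAt_clm diff h0)
    have h2 := Complex.reCLM.hasFDerivAt.comp_hasDerivAt t
      (hasDerivAt_quad h0 h0.star h0 h0.star)
    refine (h1.sub (h2.const_mul (ν / 2))).congr_deriv ?_
    have e1 : pair (star (diff (u t))) (diff u') = -pair (star (lap (u t))) u' := by
      rw [← diff_star, ← lap_star, pair_lap_left, pair_lap_right, neg_neg]
    have e2 : quad u' (star (u t)) (u t) (star (u t)) = pair (star (cubic (u t))) u' := by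
      rw [quad_eq_tsum]; simp only [pair, cubic, star_apply', mul_apply, map_mul, Complex.conj_conj]
      congr 1; ext k; ring
    have e3 : quad (u t) (star (u t)) u' (star (u t)) = pair (star (cubic (u t))) u' := by
      rw [quad_eq_tsum]; simp only [pair, cubic, star_apply', mul_apply, map_mul, Complex.conj_conj]
      congr 1; ext k; ring
    have e4 : quad (u t) (star u') (u t) (star (u t)) = conj (pair (star (cubic (u t))) u') := by
      rw [← pair_star, star_star, quad_eq_tsum]; simp only [pair, cubic, star_apply', mul_apply]
      congr 1; ext k; ring
    have e5 : quad (u t) (star (u t)) (u t) (star u') = conj (pair (star (cubic (u t))) u') := by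
      rw [← pair_star, star_star, quad_eq_tsum]; simp only [pair, cubic, star_apply', mul_apply]
    -- The derivative of the Hamiltonian is `-2 Re ⟨X, u'⟩`, and `u' = -i X` makes it vanish.
    have e6 : (pair (star X) u').re = 0 := by
      rw [hu', pair_smul_right, pair_star_self, neg_mul, Complex.neg_re, Complex.mul_re,
        Complex.ofReal_im, Complex.I_re]
      ring
    have e7 : (pair (star X) u').re
        = (pair (star (lap (u t))) u').re + ν * (pair (star (cubic (u t))) u').re := by
      rw [hX, star_add, star_smul, pair_add_left, pair_smul_left, Complex.add_re]
      simp
    rw [e1, e2, e3, e4, e5]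
    simp only [Complex.reCLM_apply, Complex.add_re, Complex.conj_re, Complex.neg_re]
    linear_combination 2 * e7 - 2 * e6
  exact is_const_of_deriv_eq_zero (fun t => (hderiv t).differentiableAt)
    (fun t => (hderiv t).deriv) t 0

theorem abs_quad_self_le (a : Seq) :
    |(quad a (star a) a (star a)).re| ≤ 2 * ‖a‖ ^ 3 * ‖diff a‖ := by
  refine (Complex.abs_re_le_norm _).trans ?_
  have hB : ∀ k, ‖a k‖ ≤ Real.sqrt (2 * ‖a‖ * ‖diff a‖) := fun k =>
    Real.le_sqrt_of_sq_le (norm_sq_apply_le a k)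
  refine (norm_quad_le a (star a) a (star a) hB
    (fun k => by rw [star_apply', RCLike.norm_conj]; exact hB k)).trans (le_of_eq ?_)
  rw [norm_star, Real.mul_self_sqrt (by positivity)]
  ring

theorem norm_diff_le_two_mul (hν : ν = -1 ∨ ν = 1) (hu : IsFlow ν u) (t : ℝ) :
    ‖diff (u t)‖ ≤ 2 * (‖diff (u 0)‖ + ‖u 0‖ ^ 3) := by
  have h := hu.hamiltonian_eq t
  simp only [hamiltonian] at h
  have h1 := abs_quad_self_le (u t)
  have h2 := abs_quad_self_le (u 0)
  rw [hu.norm_eq t] at h1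
  have h3 := norm_nonneg (diff (u 0))
  have h4 := norm_nonneg (diff (u t))
  have h5 : 0 ≤ ‖u 0‖ ^ 3 := by positivity
  set x := ‖diff (u t)‖
  set y := ‖diff (u 0)‖
  set z := ‖u 0‖ ^ 3
  set p := (quad (u t) (star (u t)) (u t) (star (u t))).re
  set q := (quad (u 0) (star (u 0)) (u 0) (star (u 0))).re
  have hpq : x ^ 2 ≤ y ^ 2 + z * x + z * y := by
    have a1 := abs_le.1 h1
    have a2 := abs_le.1 h2
    rcases hν with rfl | rfl <;> nlinarith
  -- If `x > 2 (y + z)`, then `x² > 2xy + 2xz ≥ y² + zx + zy`, against `hpq`.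
  by_contra hcon
  push Not at hcon
  nlinarith

end IsFlow

/-! ### The modified energy -/

/-- The quadratic part of the modified energy. -/
noncomputable def mainEnergy (n : ℕ) (a : Seq) : ℝ :=
  ∑ l ∈ Finset.Icc n (2 * n - 1),
    ((2 * n - 1).choose l : ℝ) * ‖(diff ^ l * avg ^ (2 * n - 1 - l)) a‖ ^ 2

/-- Every term contains at least `n` differences, and the remaining operators are bounded on `ℓ²`.
-/
theorem mainEnergy_le (n : ℕ) : ∃ K : ℝ, 0 ≤ K ∧ ∀ a, mainEnergy n a ≤ K * ‖(diff ^ n) a‖ ^ 2 := by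
  refine ⟨∑ l ∈ Finset.Icc n (2 * n - 1), ((2 * n - 1).choose l : ℝ) *
    (2 ^ (l - n) * 2 ^ (2 * n - 1 - l)) ^ 2, by positivity, fun a => ?_⟩
  rw [mainEnergy, Finset.sum_mul]
  refine Finset.sum_le_sum fun l hl => ?_
  rw [Finset.mem_Icc] at hl
  rw [mul_assoc, ← mul_pow]
  gcongr
  obtain ⟨k, rfl⟩ := Nat.exists_eq_add_of_le hl.1
  have hc : diff ^ (n + k) * avg ^ (2 * n - 1 - (n + k))
      = diff ^ k * avg ^ (2 * n - 1 - (n + k)) * diff ^ n := by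
    rw [mul_assoc, (commute_avg_diff.pow_pow _ _).eq, ← mul_assoc, ← pow_add, add_comm k]
  rw [hc, mul_apply_eq_comp, mul_apply_eq_comp, Nat.add_sub_cancel_left]
  refine (norm_diff_pow_le _ _).trans ?_
  rw [mul_assoc]
  gcongr
  exact norm_avg_pow_le _ _

/-- The parallelogram law iterated `m` times, with Pascal's rule for the coefficients. -/
theorem four_pow_mul_norm_sq (m : ℕ) (b : Seq) :
    4 ^ m * ‖b‖ ^ 2 = ∑ ij ∈ Finset.HasAntidiagonal.antidiagonal m,
      (m.choose ij.1 : ℝ) * ‖(diff ^ ij.1 * avg ^ ij.2) b‖ ^ 2 := by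
  induction m generalizing b with
  | zero => simp
  | succ m ih =>
    rw [Finset.sum_antidiagonal_choose_succ_mul (fun i j => ‖(diff ^ i * avg ^ j) b‖ ^ 2)]
    have h1 : ∑ ij ∈ Finset.HasAntidiagonal.antidiagonal m,
        (m.choose ij.1 : ℝ) * ‖(diff ^ ij.1 * avg ^ (ij.2 + 1)) b‖ ^ 2 = 4 ^ m * ‖avg b‖ ^ 2 := by
      rw [ih]
      refine Finset.sum_congr rfl fun ij _ => ?_
      rw [pow_succ avg, ← mul_assoc, mul_apply_eq_comp _ avg]
    have h2 : ∑ ij ∈ Finset.HasAntidiagonal.antidiagonal m,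
        (m.choose ij.2 : ℝ) * ‖(diff ^ (ij.1 + 1) * avg ^ ij.2) b‖ ^ 2 = 4 ^ m * ‖diff b‖ ^ 2 := by
      rw [ih]
      refine Finset.sum_congr rfl fun ij hij => ?_
      rw [Finset.HasAntidiagonal.mem_antidiagonal] at hij
      rw [Nat.choose_symm_of_eq_add (by omega : m = ij.2 + ij.1), pow_succ diff, mul_assoc,
        ← (commute_avg_diff.pow_left _).eq, ← mul_assoc, mul_apply_eq_comp _ diff]
    rw [h1, h2, pow_succ]
    linear_combination -(4 : ℝ) ^ m * norm_diff_sq_add_norm_avg_sq b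

/-- Coercivity: expanding `4^(n-1) ‖D^n a‖²` produces the same operators as the energy, and the
binomial coefficients `(n-1).choose i` are dominated by `(2n-1).choose (n+i)`. -/
theorem norm_diff_pow_sq_le_mainEnergy (n : ℕ) (hn : 1 ≤ n) (a : Seq) :
    ‖(diff ^ n) a‖ ^ 2 ≤ mainEnergy n a := by
  have h1 : ‖(diff ^ n) a‖ ^ 2 ≤ 4 ^ (n - 1) * ‖(diff ^ n) a‖ ^ 2 :=
    le_mul_of_one_le_left (by positivity) (one_le_pow₀ (by norm_num))
  refine h1.trans ?_
  rw [four_pow_mul_norm_sq, mainEnergy, Finset.Nat.sum_antidiagonal_eq_sum_range_succ_mk]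
  have hterm : ∀ i ∈ Finset.range (n - 1).succ,
      ((n - 1).choose i : ℝ) * ‖(diff ^ i * avg ^ (n - 1 - i)) ((diff ^ n) a)‖ ^ 2
        ≤ ((2 * n - 1).choose (n + i) : ℝ) *
          ‖(diff ^ (n + i) * avg ^ (2 * n - 1 - (n + i))) a‖ ^ 2 := by
    intro i hi
    rw [Finset.mem_range] at hi
    rw [← mul_apply_eq_comp, mul_assoc, (commute_avg_diff.pow_pow _ _).eq, ← mul_assoc, ← pow_add,
      add_comm i, show 2 * n - 1 - (n + i) = n - 1 - i by omega]
    gcongr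
    rw [← Nat.choose_symm (show i ≤ n - 1 by omega),
      ← Nat.choose_symm (show n + i ≤ 2 * n - 1 by omega),
      show 2 * n - 1 - (n + i) = n - 1 - i by omega]
    exact Nat.choose_le_choose _ (by omega)
  refine (Finset.sum_le_sum hterm).trans (le_of_eq ?_)
  refine Finset.sum_nbij' (fun i => n + i) (fun l => l - n) ?_ ?_ ?_ ?_ ?_
  · intro i hi; rw [Finset.mem_range] at hi; rw [Finset.mem_Icc]; omega
  · intro l hl; rw [Finset.mem_Icc] at hl; rw [Finset.mem_range]; omega
  · intro i hi; omega
  · intro l hl; rw [Finset.mem_Icc] at hl; omega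
  · intro i hi; rfl

theorem pair_diff_pow_right (l : ℕ) (a b : Seq) :
    pair a ((diff ^ l) b) = (-1) ^ l * pair ((diff ^ l) a) ((shift ^ l) b) := by
  induction l generalizing a b with
  | zero => simp
  | succ l ih =>
    rw [pow_succ' diff l, mul_apply_eq_comp, pair_comm, pair_diff_left, pair_comm,
      apply_comm_of_commute (commute_shift_diff.pow_right l), ih, ← mul_apply_eq_comp,
      ← mul_apply_eq_comp, ← pow_succ, ← pow_succ, ← pow_succ', pow_succ (-1 : ℂ)]
    ring

theorem pair_avg_pow_right (l : ℕ) (a b : Seq) :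
    pair a ((avg ^ l) b) = pair ((avg ^ l) a) ((shift ^ l) b) := by
  induction l generalizing a b with
  | zero => simp
  | succ l ih =>
    rw [pow_succ' avg l, mul_apply_eq_comp, pair_comm, pair_avg_left, pair_comm,
      apply_comm_of_commute (commute_shift_avg.pow_right l), ih, ← mul_apply_eq_comp,
      ← mul_apply_eq_comp, ← pow_succ, ← pow_succ, ← pow_succ']

theorem pair_diff_avg_pow (l i : ℕ) (a b : Seq) :
    pair ((diff ^ l * avg ^ i) a) ((diff ^ l * avg ^ i) b)
      = (-1) ^ l * pair ((diff ^ (2 * l) * avg ^ (2 * i)) a) ((shift ^ (l + i)) b) := by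
  rw [mul_apply_eq_comp (diff ^ l) (avg ^ i) b, pair_diff_pow_right,
    apply_comm_of_commute (commute_shift_avg.pow_pow l i), pair_avg_pow_right,
    ← mul_apply_eq_comp, ← mul_apply_eq_comp, ← mul_apply_eq_comp, ← pow_add, add_comm i l]
  have e : avg ^ i * (diff ^ l * (diff ^ l * avg ^ i)) = diff ^ (2 * l) * avg ^ (2 * i) := by
    rw [← mul_assoc (diff ^ l), ← pow_add, ← two_mul, ← mul_assoc,
      (commute_avg_diff.pow_pow _ _).eq, mul_assoc, ← pow_add, ← two_mul]
  rw [← e]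
  rfl

theorem sum_pair_eq_pair_aeval (n : ℕ) (a b : Seq) :
    ∑ l ∈ Finset.Icc n (2 * n - 1), ((2 * n - 1).choose l : ℂ) *
      pair ((diff ^ l * avg ^ (2 * n - 1 - l)) a) ((diff ^ l * avg ^ (2 * n - 1 - l)) b)
      = pair (Polynomial.aeval shift (energyPoly n) a) ((shift ^ (2 * n - 1)) b) := by
  have hsum : ∀ (s : Finset ℕ) (g : ℕ → Seq) (y : Seq),
      pair (∑ i ∈ s, g i) y = ∑ i ∈ s, pair (g i) y := by
    intro s g y
    induction s using Finset.induction_on with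
    | empty => simpa using pair_smul_left 0 0 y
    | insert i s hi ih => rw [Finset.sum_insert hi, Finset.sum_insert hi, pair_add_left, ih]
  rw [energyPoly, map_sum, sum_apply, hsum]
  refine Finset.sum_congr rfl fun l hl => ?_
  rw [Finset.mem_Icc] at hl
  rw [pair_diff_avg_pow, show l + (2 * n - 1 - l) = 2 * n - 1 by omega, map_mul,
    Polynomial.aeval_C, ← Algebra.smul_def, smul_apply, pair_smul_left]
  simp only [map_mul, map_pow, map_sub, map_add, Polynomial.aeval_X, map_one]
  rw [mul_assoc]
  rfl

end DNLS

namespace DNLS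

/-! ### Time derivatives of the energy and of its quartic correction. -/

open scoped ComplexConjugate

/-- The quartic expression that the modified energy removes. -/
noncomputable def resonant (n : ℕ) (a : Seq) : ℂ :=
  quad (Polynomial.aeval shift (energyPoly n) a) ((shift ^ (2 * n - 1)) (star a))
    ((shift ^ (2 * n - 1)) a) ((shift ^ (2 * n - 1)) (star a))

theorem conj_resonant (n : ℕ) (a : Seq) :
    conj (resonant n a)
      = pair (Polynomial.aeval shift (energyPoly n) (star a)) ((shift ^ (2 * n - 1)) (cubic a)) := by
  rw [resonant, ← quad_star, aeval_shift_star _ (conj_coeff_energyPoly n), quad_eq_pair, cubic,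
    shift_pow_mul, shift_pow_mul, shift_pow_star, star_star]

namespace IsFlow

variable {ν : ℝ} {u : ℝ → Seq}

theorem hasDerivAt_mainEnergy (hu : IsFlow ν u) (n : ℕ) (t : ℝ) :
    HasDerivAt (fun s => mainEnergy n (u s)) (-2 * ν * (resonant n (u t)).im) t := by
  have hl : ∀ l ∈ Finset.Icc n (2 * n - 1),
      HasDerivAt (fun s => ((2 * n - 1).choose l : ℝ) *
        ‖(diff ^ l * avg ^ (2 * n - 1 - l)) (u s)‖ ^ 2)
      (2 * ν * (((2 * n - 1).choose l : ℂ) *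
        pair ((diff ^ l * avg ^ (2 * n - 1 - l)) (star (u t)))
          ((diff ^ l * avg ^ (2 * n - 1 - l)) (cubic (u t)))).im) t := by
    intro l _
    set Λ := diff ^ l * avg ^ (2 * n - 1 - l) with hΛ
    have hlap : Commute lap Λ := (commute_lap_diff.pow_right _).mul_right (commute_lap_avg.pow_right _)
    have hstar : Λ (star (u t)) = star (Λ (u t)) := by
      have havg : ∀ i : ℕ, ∀ b : Seq, (avg ^ i) (star b) = star ((avg ^ i) b) := by
        intro i b
        induction i with
        | zero => simp
        | succ i ih => rw [pow_succ', mul_apply_eq_comp, ih, avg_star, mul_apply_eq_comp]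
      rw [hΛ, mul_apply_eq_comp, mul_apply_eq_comp, havg, diff_pow_star]
    -- The linear part drops out: `Λ` commutes with `lap`, and `⟨Λu, lap Λu⟩` is real.
    refine ((hasDerivAt_norm_sq (hasDerivAt_clm Λ (hu t))).const_mul _).congr_deriv ?_
    rw [map_smul, map_add, map_smul, ← apply_comm_of_commute hlap, pair_smul_right, pair_add_right,
      pair_smul_right, pair_star_lap_self, hstar]
    simp only [Complex.mul_re, Complex.mul_im, Complex.neg_re, Complex.neg_im, Complex.I_re,
      Complex.I_im, Complex.add_re, Complex.add_im, Complex.ofReal_re, Complex.ofReal_im,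
      Complex.natCast_re, Complex.natCast_im]
    ring
  refine (HasDerivAt.fun_sum hl).congr_deriv ?_
  rw [← Finset.mul_sum, ← Complex.im_sum, sum_pair_eq_pair_aeval, ← conj_resonant, Complex.conj_im]
  ring

end IsFlow

/-- Shifting all four arguments at once turns `lap` into `diff` applied twice and cancels `unshift`,
so the symbol of the Laplacian becomes polynomial. -/
theorem quadForm_lap₀ (a b c e : Seq) (f : MvPolynomial (Fin 3) ℂ) :
    quadForm (lap a) b c (unshift e) f
      = quadForm a b c e ((var 0 - 1) ^ 2 * (var 1 * var 2) * f) := by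
  rw [← quadForm_shift, shift_unshift, shift_lap, ← quadForm_X₀_mul, ← quadForm_X₀_mul,
    ← quadForm_var₁_mul, ← quadForm_var₂_mul]
  congr 1
  simp only [var]; ring

theorem quadForm_lap₁ (a b c e : Seq) (f : MvPolynomial (Fin 3) ℂ) :
    quadForm a (lap b) c (unshift e) f
      = quadForm a b c e ((var 1 - 1) ^ 2 * (var 0 * var 2) * f) := by
  rw [← quadForm_shift, shift_unshift, shift_lap, ← quadForm_X₁_mul, ← quadForm_X₁_mul,
    ← quadForm_var₀_mul, ← quadForm_var₂_mul]
  congr 1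
  simp only [var]; ring

theorem quadForm_lap₂ (a b c e : Seq) (f : MvPolynomial (Fin 3) ℂ) :
    quadForm a b (lap c) (unshift e) f
      = quadForm a b c e ((var 2 - 1) ^ 2 * (var 0 * var 1) * f) := by
  rw [← quadForm_shift, shift_unshift, shift_lap, ← quadForm_X₂_mul, ← quadForm_X₂_mul,
    ← quadForm_var₀_mul, ← quadForm_var₁_mul]
  congr 1
  simp only [var]; ring

theorem quadForm_lap₃ (a b c e : Seq) (f : MvPolynomial (Fin 3) ℂ) :
    quadForm a b c (lap (unshift e)) f
      = quadForm a b c e ((var 0 * var 1 * var 2 - 1) ^ 2 * f) := by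
  have : lap (unshift e) = e + (-2 : ℂ) • unshift e + unshift (unshift e) := by
    ext k
    simp only [lap_apply, lp.coeFn_add, Pi.add_apply, lp.coeFn_smul, Pi.smul_apply, smul_eq_mul,
      unshift_apply, add_sub_cancel_right]
    ring
  rw [this, quadForm_add₃, quadForm_add₃, quadForm_smul₃, quadForm_unshift, quadForm_unshift,
    quadForm_unshift, ← smul_eq_mul, ← map_smul, ← map_add, ← map_add]
  congr 1
  rw [MvPolynomial.smul_eq_C_mul, map_neg, map_ofNat]
  ring

/-- The quartic correction of the modified energy. -/
noncomputable def correction (n : ℕ) (Q : MvPolynomial (Fin 3) ℂ) (a : Seq) : ℂ :=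
  quadForm a (star a) a ((shift ^ (2 * n - 2)) (star a)) Q

/-- The sextic expression in the derivative of the quartic correction. -/
noncomputable def sextic (n : ℕ) (Q : MvPolynomial (Fin 3) ℂ) (a : Seq) : ℂ :=
  quadForm (cubic a) (star a) a ((shift ^ (2 * n - 2)) (star a)) Q
    - quadForm a (star (cubic a)) a ((shift ^ (2 * n - 2)) (star a)) Q
    + quadForm a (star a) (cubic a) ((shift ^ (2 * n - 2)) (star a)) Q
    - quadForm a (star a) a ((shift ^ (2 * n - 2)) (star (cubic a))) Q

/-- The alternating sum of the four Laplacian symbols is minus the resonance function, hence its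
product with `Q` is minus the alternating sum of `σ`. Clearing the Laplacian's denominators uses one
shift, which is why the correction has `2n - 2` where the symbol has `2n - 1`. -/
theorem quadForm_lap_altSum (n : ℕ) (hn : 1 ≤ n) (Q : MvPolynomial (Fin 3) ℂ)
    (hQ : altSum (2 * n - 1) (var 0) (var 1) (var 2) (energyPoly n)
        = Q * ((1 + var 0 * var 2) * (1 - var 0 * var 1) * (1 - var 1 * var 2))) (a : Seq) :
    quadForm (lap a) (star a) a ((shift ^ (2 * n - 2)) (star a)) Q
    - quadForm a (star (lap a)) a ((shift ^ (2 * n - 2)) (star a)) Q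
    + quadForm a (star a) (lap a) ((shift ^ (2 * n - 2)) (star a)) Q
    - quadForm a (star a) a ((shift ^ (2 * n - 2)) (star (lap a))) Q
      = -(4 * Complex.I * (resonant n a).im) := by
  have he : (shift ^ (2 * n - 2)) (star a) = unshift ((shift ^ (2 * n - 1)) (star a)) := by
    rw [show 2 * n - 1 = 2 * n - 2 + 1 by omega, pow_succ', mul_apply_eq_comp, unshift_shift]
  rw [← lap_star, ← apply_comm_of_commute (commute_lap_shift.pow_right _), he, quadForm_lap₀,
    quadForm_lap₁, quadForm_lap₂, quadForm_lap₃, resonant, ← quadForm_altSum, hQ]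
  simp only [← map_neg, ← map_sub, ← map_add]
  refine congrArg _ ?_
  generalize var 0 = x, var 1 = y, var 2 = z
  ring

namespace IsFlow

variable {ν : ℝ} {u : ℝ → Seq}

theorem hasDerivAt_correction (hu : IsFlow ν u) (n : ℕ) (hn : 1 ≤ n) (Q : MvPolynomial (Fin 3) ℂ)
    (hQ : altSum (2 * n - 1) (var 0) (var 1) (var 2) (energyPoly n)
        = Q * ((1 + var 0 * var 2) * (1 - var 0 * var 1) * (1 - var 1 * var 2))) (t : ℝ) :
    HasDerivAt (fun s => correction n Q (u s))
      (-4 * (resonant n (u t)).im - Complex.I * ν * sextic n Q (u t)) t := by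
  refine (hasDerivAt_quadForm (hu t) (hu t).star (hu t)
    (hasDerivAt_clm _ (hu t).star) Q).congr_deriv ?_
  have h := quadForm_lap_altSum n hn Q hQ (u t)
  simp only [star_smul, star_add, map_add, map_smul, quadForm_smul₀, quadForm_smul₁, quadForm_smul₂,
    quadForm_smul₃, quadForm_add₀, quadForm_add₁, quadForm_add₂, quadForm_add₃, sextic,
    star_neg, Complex.star_def, Complex.conj_I, Complex.conj_ofReal, neg_neg]
  linear_combination -Complex.I * h + 4 * (resonant n (u t)).im * Complex.I_sq

/-- The weight `ν / 2` matches `-2ν` against `-4`, so the quartic terms cancel; the sextic term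
remains, with `ν² = 1`. -/
theorem hasDerivAt_energy (hν : ν = -1 ∨ ν = 1) (hu : IsFlow ν u) (n : ℕ) (hn : 1 ≤ n)
    (Q : MvPolynomial (Fin 3) ℂ)
    (hQ : altSum (2 * n - 1) (var 0) (var 1) (var 2) (energyPoly n)
        = Q * ((1 + var 0 * var 2) * (1 - var 0 * var 1) * (1 - var 1 * var 2))) (t : ℝ) :
    HasDerivAt (fun s => mainEnergy n (u s) - ν / 2 * (correction n Q (u s)).re)
      (-(sextic n Q (u t)).im / 2) t := by
  have h1 := hu.hasDerivAt_mainEnergy n t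
  have h2 := Complex.reCLM.hasFDerivAt.comp_hasDerivAt t (hu.hasDerivAt_correction n hn Q hQ t)
  refine (h1.sub (h2.const_mul (ν / 2))).congr_deriv ?_
  have e : Complex.reCLM (-4 * (resonant n (u t)).im - Complex.I * ν * sextic n Q (u t))
      = -4 * (resonant n (u t)).im + ν * (sextic n Q (u t)).im := by
    simp
  rw [e]
  have : ν * ν = 1 := by rcases hν with rfl | rfl <;> norm_num
  linear_combination -(sextic n Q (u t)).im / 2 * this

end IsFlow

/-! ### Tame bounds along the flow -/

theorem Tame.cubic {N : ℕ} {κ L c : ℝ} {f : Seq} (hκ : 0 < κ) (hL : 1 ≤ L)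
    (hf : Tame N κ L 0 c f) :
    Tame N κ L 0 (4 ^ N * c ^ 3 * κ ^ 4) (cubic f) := by
  have h := (hf.mul hκ hL hf.star).mul hκ hL hf
  have e : (2 : ℝ) ^ N * (2 ^ N * (c * c * κ ^ 2) * c * κ ^ 2) = 4 ^ N * c ^ 3 * κ ^ 4 := by
    rw [show (4 : ℝ) ^ N = 2 ^ N * 2 ^ N by rw [← mul_pow]; norm_num]; ring
  rw [← e]
  exact h

/-- A log-convex sequence that is at most one at both ends is at most one. -/
theorem le_one_of_sq_le_mul (n : ℕ) (y : ℕ → ℝ) (hy : ∀ j, 0 ≤ y j) (h0 : y 0 ≤ 1)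
    (hn : y n ≤ 1) (hc : ∀ j, y (j + 1) ^ 2 ≤ y j * y (j + 2)) (j : ℕ) (hj : j ≤ n) : y j ≤ 1 := by
  by_contra hcon
  push Not at hcon
  obtain ⟨m, hm, hmax⟩ := Finset.exists_max_image (Finset.range (n + 1)) y ⟨0, by simp⟩
  have hm1 : 1 < y m := hcon.trans_le (hmax j (Finset.mem_range.2 (by omega)))
  have hex : ∃ i, i ≤ n ∧ y i = y m := ⟨m, by rw [Finset.mem_range] at hm; omega, rfl⟩
  classical
  have hspec := Nat.find_spec hex
  have hmin := fun i => Nat.find_min (H := hex) (m := i)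
  set k := Nat.find hex
  have hk0 : k ≠ 0 := by
    intro h; rw [h] at hspec; linarith [hspec.2]
  have hkn : k ≠ n := by
    intro h; rw [h] at hspec; linarith [hspec.2]
  obtain ⟨i, hi⟩ := Nat.exists_eq_succ_of_ne_zero hk0
  -- The index `k` is the leftmost maximum, so the inequality on its left is strict, which
  -- contradicts log-convexity there.
  have hlt : y i < y m := by
    refine lt_of_le_of_ne (hmax i (Finset.mem_range.2 (by omega))) fun he => ?_
    exact hmin i (by omega) ⟨by omega, he⟩
  have hle : y (i + 2) ≤ y m := hmax _ (Finset.mem_range.2 (by omega))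
  have h := hc i
  rw [show i + 1 = k by omega, hspec.2] at h
  nlinarith [hy i, hy (i + 2)]

/-- For `j ≥ 1` the right-hand sides form a geometric progression, so the quotients are still
log-convex, and they are at most one at both ends. -/
theorem norm_diff_pow_le_of_bounds {n : ℕ} (hn : 1 ≤ n) {κ L : ℝ} (hκ : 0 < κ) (hL : 1 ≤ L)
    {a : Seq} (h1 : ‖diff a‖ ≤ κ ^ 3) (hn' : ‖(diff ^ n) a‖ ≤ κ ^ (2 * n + 1) * L ^ (2 * n - 2))
    {j : ℕ} (hj1 : 1 ≤ j) (hjn : j ≤ n) :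
    ‖(diff ^ j) a‖ ≤ κ ^ (2 * j + 1) * L ^ (2 * j - 2) := by
  have hL0 : 0 < L := by linarith
  obtain ⟨i, rfl⟩ := Nat.exists_eq_add_of_le' hj1
  obtain ⟨m, rfl⟩ := Nat.exists_eq_add_of_le' hn
  have h := le_one_of_sq_le_mul m
    (fun i => ‖(diff ^ (i + 1)) a‖ / (κ ^ (2 * (i + 1) + 1) * L ^ (2 * i)))
    (fun i => by positivity)
    (by
      rw [div_le_one (by positivity)]
      simpa using h1)
    (by
      rw [div_le_one (by positivity)]
      rwa [show 2 * (m + 1) - 2 = 2 * m by omega] at hn')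
    (fun i => by
      rw [div_pow, div_mul_div_comm, div_le_div_iff₀ (by positivity) (by positivity)]
      have e : κ ^ (2 * (i + 1) + 1) * L ^ (2 * i) * (κ ^ (2 * (i + 2 + 1) + 1) * L ^ (2 * (i + 2)))
          = (κ ^ (2 * (i + 1 + 1) + 1) * L ^ (2 * (i + 1))) ^ 2 := by ring
      rw [e]
      exact mul_le_mul_of_nonneg_right (norm_diff_pow_sq_le (i + 1) a) (by positivity))
    i (by omega)
  rw [div_le_one (by positivity)] at h
  rwa [show 2 * (i + 1) - 2 = 2 * i by omega]

/-- A supremum bound of order `i` uses the `ℓ²` bounds of orders `i` and `i + 1`, so control of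
order `N + 1` is needed for tameness up to `N`. -/
theorem tame_of_bounds {N : ℕ} {κ L : ℝ} (hκ : 0 < κ) (hL : 1 ≤ L)
    {a : Seq} (h0 : ‖a‖ ≤ κ) (h1 : ‖diff a‖ ≤ κ ^ 3)
    (hn : ‖(diff ^ (N + 1)) a‖ ≤ κ ^ (2 * (N + 1) + 1) * L ^ (2 * (N + 1) - 2)) :
    Tame N κ L 0 2 a := by
  have hL0 : 0 < L := by linarith
  have hb : ∀ j ≤ N + 1, ‖(diff ^ j) a‖ ≤ κ ^ (2 * j + 1) * L ^ (2 * j - 2) := by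
    intro j hj
    rcases Nat.eq_zero_or_pos j with rfl | hj0
    · simpa using h0
    · exact norm_diff_pow_le_of_bounds (by omega) hκ hL h1 hn hj0 hj
  refine ⟨by norm_num, fun i hi => ?_, fun i hi k => ?_⟩
  · rw [zero_add] at hi ⊢
    refine (hb i (by omega)).trans ?_
    rw [mul_assoc]
    exact le_mul_of_one_le_left (by positivity) (by norm_num)
  · rw [zero_add] at hi ⊢
    refine (sq_le_sq₀ (norm_nonneg _) (by positivity)).1 ?_
    refine (norm_sq_apply_le _ k).trans ?_
    rw [← mul_apply_eq_comp diff, ← pow_succ']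
    have hi1 := hb i (by omega)
    have hi2 := hb (i + 1) (by omega)
    calc 2 * ‖(diff ^ i) a‖ * ‖(diff ^ (i + 1)) a‖
        ≤ 2 * (κ ^ (2 * i + 1) * L ^ (2 * i - 2)) *
          (κ ^ (2 * (i + 1) + 1) * L ^ (2 * (i + 1) - 2)) := by gcongr
      _ = 2 * κ ^ (4 * i + 4) * L ^ (2 * i - 2 + (2 * (i + 1) - 2)) := by ring
      _ ≤ 4 * κ ^ (4 * i + 4) * L ^ (2 * (2 * i - 1)) := by
        gcongr
        · norm_num
        · omega
      _ = _ := by ring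

end DNLS

namespace DNLS

/-! ### From the differential inequality to polynomial growth. -/

/-- A differential inequality `|e'| ≤ K k X^(N-1)` with `X^N` comparable to `e` up to lower order
terms gives polynomial growth of degree `N`. -/
theorem growth_of_deriv_bound (N : ℕ) (hN : 1 ≤ N) (A K K' : ℝ) (hA : 0 ≤ A) (hK : 0 ≤ K)
    (hK' : 0 ≤ K') :
    ∃ C : ℝ, 0 < C ∧ ∀ (Y X e e' : ℝ → ℝ) (k : ℝ), 0 ≤ k → (∀ t, 0 ≤ Y t) → (∀ t, 1 ≤ X t) →
      (∀ t, X t ^ N = max 1 (Y t)) → (∀ t, HasDerivAt e (e' t) t) →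
      (∀ t, Y t - A * X t ^ (N - 1) ≤ e t) → (e 0 ≤ K' * Y 0 + A * X 0 ^ (N - 1)) →
      (∀ t, |e' t| ≤ K * k * X t ^ (N - 1)) →
      ∀ t, Y t ≤ C * (1 + Y 0 + (k * |t|) ^ N) := by
  -- This absorbs the lower order term: `A X^(N-1)` is at most `X^N / 2` when `X ≥ 2A`, and at most
  -- `A (2A)^(N-1)` otherwise. The `1` covers `X^N ≤ Y + 1`.
  set B : ℝ := 1 + A * (2 * A) ^ (N - 1) with hB
  have hB0 : 0 ≤ B := by positivity
  refine ⟨2 ^ N * (K' + 2 * A + B + (K * 2 ^ (N - 1)) ^ N) + 1, by positivity, ?_⟩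
  intro Y X e e' k hk hY hX hXY he hlow hup he' t
  have hN0 : (N : ℝ) ≠ 0 := by positivity
  have hXY' : ∀ t, X t ^ N ≤ Y t + 1 := fun t => by
    rw [hXY]; exact max_le (by linarith [hY t]) (by linarith)
  have hXN : ∀ t, X t ^ N = X t * X t ^ (N - 1) := fun t => by
    rw [← pow_succ', Nat.sub_add_cancel hN]
  have hG : ∀ t, X t ^ N / 2 ≤ e t + B := by
    intro t
    have h1 : A * X t ^ (N - 1) ≤ X t ^ N / 2 + A * (2 * A) ^ (N - 1) := by
      have hX0 : 0 ≤ X t := by linarith [hX t]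
      rcases le_total (2 * A) (X t) with h | h
      · have : A * X t ^ (N - 1) ≤ X t / 2 * X t ^ (N - 1) := by gcongr; linarith
        rw [hXN]
        have h2 : 0 ≤ A * (2 * A) ^ (N - 1) := by positivity
        linarith
      · have : A * X t ^ (N - 1) ≤ A * (2 * A) ^ (N - 1) := by gcongr
        have h2 : 0 ≤ X t ^ N / 2 := by positivity
        linarith
    linarith [hlow t, hXY' t]
  have hGpos : ∀ t, 0 < e t + B := fun t => by
    have : (1 : ℝ) ≤ X t ^ N := one_le_pow₀ (hX t)
    linarith [hG t]
  -- The `N`-th root linearises the inequality: `φ` is Lipschitz with constant a multiple of `k`.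
  set φ : ℝ → ℝ := fun t => (e t + B) ^ (1 / (N : ℝ)) with hφ
  have hφpos : ∀ t, 0 < φ t := fun t => Real.rpow_pos_of_pos (hGpos t) _
  have hφN : ∀ t, φ t ^ N = e t + B := fun t => by
    simp only [hφ]
    rw [← Real.rpow_natCast, ← Real.rpow_mul (hGpos t).le, one_div_mul_cancel hN0, Real.rpow_one]
  have hXφ : ∀ t, X t ≤ 2 * φ t := fun t => by
    refine le_of_pow_le_pow_left₀ (by omega : N ≠ 0) (by linarith [hφpos t]) ?_
    rw [mul_pow, hφN]
    have h2 : (2 : ℝ) ≤ 2 ^ N := by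
      calc (2 : ℝ) = 2 ^ 1 := (pow_one _).symm
        _ ≤ 2 ^ N := pow_le_pow_right₀ (by norm_num) hN
    have := mul_le_mul_of_nonneg_right h2 (hGpos t).le
    linarith [hG t]
  have hφ' : ∀ t, HasDerivAt φ (e' t * (1 / (N : ℝ)) * (e t + B) ^ (1 / (N : ℝ) - 1)) t :=
    fun t => ((he t).add_const B).rpow_const (Or.inl (hGpos t).ne')
  have hbound : ∀ t, ‖e' t * (1 / (N : ℝ)) * (e t + B) ^ (1 / (N : ℝ) - 1)‖
      ≤ K * 2 ^ (N - 1) * k := by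
    intro t
    have h1 : (e t + B) ^ (1 / (N : ℝ) - 1) = φ t / φ t ^ N := by
      rw [Real.rpow_sub (hGpos t), Real.rpow_one, hφN]
    have h2 : φ t / φ t ^ N = 1 / φ t ^ (N - 1) := by
      have : φ t ^ N = φ t * φ t ^ (N - 1) := by rw [← pow_succ', Nat.sub_add_cancel hN]
      rw [this]
      have := (hφpos t).ne'
      field_simp
    rw [h1, h2, norm_mul, norm_mul, Real.norm_eq_abs, Real.norm_of_nonneg (by positivity),
      Real.norm_of_nonneg (by have := hφpos t; positivity)]
    have h3 : |e' t| ≤ K * k * (2 * φ t) ^ (N - 1) := by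
      refine (he' t).trans ?_
      have hX0 : 0 ≤ X t := by linarith [hX t]
      gcongr
      exact hXφ t
    have h4 : 1 / (N : ℝ) ≤ 1 := by
      rw [div_le_one (by positivity)]; exact_mod_cast hN
    have h5 : 0 < φ t ^ (N - 1) := pow_pos (hφpos t) _
    have hφ0 := (hφpos t).le
    calc |e' t| * (1 / (N : ℝ)) * (1 / φ t ^ (N - 1))
        ≤ K * k * (2 * φ t) ^ (N - 1) * 1 * (1 / φ t ^ (N - 1)) := by gcongr
      _ = K * 2 ^ (N - 1) * k := by
        rw [mul_pow]; field_simp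
  have hlip := convex_univ.norm_image_sub_le_of_norm_hasDerivWithin_le (𝕜 := ℝ)
    (fun s _ => (hφ' s).hasDerivWithinAt) (fun s _ => hbound s) (Set.mem_univ 0) (Set.mem_univ t)
  rw [sub_zero, Real.norm_eq_abs, Real.norm_eq_abs] at hlip
  have hφt : φ t ≤ φ 0 + K * 2 ^ (N - 1) * k * |t| := by
    linarith [(abs_le.1 hlip).2]
  have hpow : φ t ^ N ≤ 2 ^ (N - 1) * (φ 0 ^ N + (K * 2 ^ (N - 1) * k * |t|) ^ N) := by
    refine (pow_le_pow_left₀ (hφpos t).le hφt N).trans ?_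
    exact add_pow_le (hφpos 0).le (by positivity) N
  rw [hφN, hφN] at hpow
  have hX0 : X 0 ^ (N - 1) ≤ Y 0 + 1 := by
    refine le_trans ?_ (hXY' 0)
    exact pow_le_pow_right₀ (hX 0) (by omega)
  have he0 : e 0 + B ≤ K' * Y 0 + A * (Y 0 + 1) + B := by
    have := mul_le_mul_of_nonneg_left hX0 hA
    linarith
  have hYt : Y t ≤ 2 * (e t + B) := by
    have := hG t
    rw [hXY] at this
    linarith [le_max_right 1 (Y t)]
  have hmul : (K * 2 ^ (N - 1) * k * |t|) ^ N = (K * 2 ^ (N - 1)) ^ N * (k * |t|) ^ N := by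
    rw [← mul_pow]; ring
  have h2N : (2 : ℝ) ^ N = 2 * 2 ^ (N - 1) := by rw [← pow_succ', Nat.sub_add_cancel hN]
  have hY0 := hY 0
  have hT : 0 ≤ (k * |t|) ^ N := by positivity
  have hKK : 0 ≤ (K * 2 ^ (N - 1)) ^ N := by positivity
  set T := (k * |t|) ^ N
  set R := (K * 2 ^ (N - 1)) ^ N
  calc Y t ≤ 2 ^ N * (e 0 + B + R * T) := by
        rw [h2N, mul_assoc, ← hmul]; linarith
    _ ≤ 2 ^ N * (K' * Y 0 + A * (Y 0 + 1) + B + R * T) := by gcongr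
    _ ≤ 2 ^ N * ((K' + 2 * A + B + R) * (1 + Y 0 + T)) := by
        gcongr
        nlinarith [mul_nonneg hK' hT, mul_nonneg hA hT, mul_nonneg hA hY0, mul_nonneg hB0 hT,
          mul_nonneg hB0 hY0, mul_nonneg hKK hY0]
    _ ≤ _ := by nlinarith

theorem norm_correction_le {n N : ℕ} {Q : MvPolynomial (Fin 3) ℂ} {K κ L : ℝ}
    (hκ : 0 < κ) (hL : 1 ≤ L)
    (hK : ∀ (κ L : ℝ), 0 < κ → 1 ≤ L → ∀ (a b c d : Seq) (ca cb cc cd : ℝ),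
      Tame N κ L 0 ca a → Tame N κ L 0 cb b → Tame N κ L 0 cc c → Tame N κ L 0 cd d →
      ‖quadForm a b c d Q‖ ≤ K * (ca * cb * cc * cd) * κ ^ (4 * N + 6) * L ^ (4 * N - 4))
    {a : Seq} {c : ℝ} (ha : Tame N κ L 0 c a) :
    ‖correction n Q a‖ ≤ K * c ^ 4 * κ ^ (4 * N + 6) * L ^ (4 * N - 4) := by
  refine (hK κ L hκ hL _ _ _ _ _ _ _ _ ha ha.star ha (ha.star.shift_pow _)).trans (le_of_eq ?_)
  ring

theorem norm_sextic_le {n N : ℕ} {Q : MvPolynomial (Fin 3) ℂ} {K κ L : ℝ}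
    (hκ : 0 < κ) (hL : 1 ≤ L)
    (hK : ∀ (κ L : ℝ), 0 < κ → 1 ≤ L → ∀ (a b c d : Seq) (ca cb cc cd : ℝ),
      Tame N κ L 0 ca a → Tame N κ L 0 cb b → Tame N κ L 0 cc c → Tame N κ L 0 cd d →
      ‖quadForm a b c d Q‖ ≤ K * (ca * cb * cc * cd) * κ ^ (4 * N + 6) * L ^ (4 * N - 4))
    {a : Seq} {c : ℝ} (ha : Tame N κ L 0 c a) :
    ‖sextic n Q a‖ ≤ 4 * K * 4 ^ N * c ^ 6 * κ ^ 4 * κ ^ (4 * N + 6) * L ^ (4 * N - 4) := by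
  have hw := ha.cubic hκ hL
  have h0 := hK κ L hκ hL _ _ _ _ _ _ _ _ hw ha.star ha (ha.star.shift_pow (2 * n - 2))
  have h1 := hK κ L hκ hL _ _ _ _ _ _ _ _ ha hw.star ha (ha.star.shift_pow (2 * n - 2))
  have h2 := hK κ L hκ hL _ _ _ _ _ _ _ _ ha ha.star hw (ha.star.shift_pow (2 * n - 2))
  have h3 := hK κ L hκ hL _ _ _ _ _ _ _ _ ha ha.star ha (hw.star.shift_pow (2 * n - 2))
  refine (norm_sub_le _ _).trans ((add_le_add ((norm_add_le _ _).trans (add_le_add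
    ((norm_sub_le _ _).trans (add_le_add h0 h1)) h2)) h3).trans (le_of_eq ?_))
  ring

theorem IsFlow.exists_norm_diff_pow_sq_le (n : ℕ) (hn : 2 ≤ n) :
    ∃ C : ℝ, 0 < C ∧ ∀ (ν : ℝ), (ν = -1 ∨ ν = 1) → ∀ (u : ℝ → Seq), IsFlow ν u →
      ∀ κ : ℝ, 0 < κ → ‖u 0‖ ≤ κ → 2 * (‖diff (u 0)‖ + ‖u 0‖ ^ 3) ≤ κ ^ 3 → ∀ t,
        ‖(diff ^ n) (u t)‖ ^ 2 ≤ C * (‖(diff ^ n) (u 0)‖ ^ 2 + κ ^ (4 * n + 2)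
          + κ ^ (8 * n - 2) * |t| ^ (n - 1)) := by
  obtain ⟨N, rfl⟩ : ∃ N, n = N + 1 := ⟨n - 1, by omega⟩
  have hN : 1 ≤ N := by omega
  obtain ⟨Q, hQ, hQdeg⟩ := exists_quotient (N + 1) (by omega)
  obtain ⟨K, hK0, hK⟩ := exists_norm_quadForm_le N hN Q hQdeg
  obtain ⟨K', hK'0, hK'⟩ := mainEnergy_le (N + 1)
  obtain ⟨C, hC, hgrowth⟩ := growth_of_deriv_bound N hN (8 * K) (2 * K * 4 ^ N * 2 ^ 6) K'
    (by positivity) (by positivity) hK'0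
  refine ⟨C, hC, fun ν hν u hu κ hκ h0 h1 t => ?_⟩
  -- Normalising by `P` makes `L^(4N) = max 1 Y` the smallest choice with `L ≥ 1` for which the top
  -- order bound of `tame_of_bounds` holds; then `L^(4N-4) = X^(N-1)`.
  set P : ℝ := κ ^ (4 * N + 6) with hP
  have hP0 : 0 < P := by positivity
  have hN0 : (N : ℝ) ≠ 0 := by positivity
  set Y : ℝ → ℝ := fun t => ‖(diff ^ (N + 1)) (u t)‖ ^ 2 / P with hY
  have hYP : ∀ t, ‖(diff ^ (N + 1)) (u t)‖ ^ 2 = Y t * P := fun t => by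
    simp only [hY]; field_simp
  set X : ℝ → ℝ := fun t => max 1 (Y t) ^ (1 / (N : ℝ)) with hX
  have hX1 : ∀ t, 1 ≤ X t := fun t => Real.one_le_rpow (le_max_left _ _) (by positivity)
  have hXN : ∀ t, X t ^ N = max 1 (Y t) := fun t => by
    simp only [hX]
    rw [← Real.rpow_natCast, ← Real.rpow_mul (by positivity), one_div_mul_cancel hN0, Real.rpow_one]
  set L : ℝ → ℝ := fun t => X t ^ (1 / 4 : ℝ) with hL
  have hL1 : ∀ t, 1 ≤ L t := fun t => Real.one_le_rpow (hX1 t) (by norm_num)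
  have hL4 : ∀ t, L t ^ 4 = X t := fun t => by
    simp only [hL]
    rw [← Real.rpow_natCast, ← Real.rpow_mul (by linarith [hX1 t])]
    norm_num
  have hLN : ∀ t, L t ^ (4 * N - 4) = X t ^ (N - 1) := fun t => by
    rw [show 4 * N - 4 = 4 * (N - 1) by omega, pow_mul, hL4]
  have htame : ∀ t, Tame N κ (L t) 0 2 (u t) := fun t => by
    have hL0 : 0 ≤ L t := by linarith [hL1 t]
    refine tame_of_bounds hκ (hL1 t) (by rwa [hu.norm_eq t])
      ((hu.norm_diff_le_two_mul hν t).trans h1) ?_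
    refine (sq_le_sq₀ (norm_nonneg _) (by positivity)).1 ?_
    rw [hYP, mul_pow, ← pow_mul, ← pow_mul, show (2 * (N + 1) - 2) * 2 = 4 * N by omega,
      pow_mul (L t), hL4, hXN, show (2 * (N + 1) + 1) * 2 = 4 * N + 6 by ring, mul_comm]
    gcongr
    exact le_max_right _ _
  set e : ℝ → ℝ := fun t =>
    (mainEnergy (N + 1) (u t) - ν / 2 * (correction (N + 1) Q (u t)).re) / P with he
  have hcorr : ∀ t, |ν / 2 * (correction (N + 1) Q (u t)).re| ≤ 8 * K * X t ^ (N - 1) * P := by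
    intro t
    have h := norm_correction_le (n := N + 1) hκ (hL1 t) hK (htame t)
    rw [hLN] at h
    have hν1 : |ν / 2| = 1 / 2 := by rcases hν with rfl | rfl <;> norm_num
    rw [abs_mul, hν1]
    have := (Complex.abs_re_le_norm _).trans h
    linarith
  -- The rate `κ ^ 4` comes from the two additional factors of `u` in the sextic form.
  have hmain := hgrowth Y X e (fun t => -(sextic (N + 1) Q (u t)).im / 2 / P) (κ ^ 4)
    (by positivity) (fun t => by positivity) hX1 hXN
    (fun t => (hu.hasDerivAt_energy hν (N + 1) (by omega) Q hQ t).div_const P)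
    (fun t => by
      simp only [he]
      rw [le_div_iff₀ hP0]
      have a1 := norm_diff_pow_sq_le_mainEnergy (N + 1) (by omega) (u t)
      have a2 := (abs_le.1 (hcorr t)).2
      rw [hYP] at a1
      linarith)
    (by
      simp only [he]
      rw [div_le_iff₀ hP0]
      have a1 := hK' (u 0)
      have a2 := (abs_le.1 (hcorr 0)).1
      rw [hYP] at a1
      linarith)
    (fun t => by
      have h := norm_sextic_le (n := N + 1) hκ (hL1 t) hK (htame t)
      rw [hLN] at h
      rw [abs_div, abs_of_pos hP0, div_le_iff₀ hP0, abs_div, abs_neg, abs_two]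
      have := (Complex.abs_im_le_norm _).trans h
      linarith)
    t
  have hfin := mul_le_mul_of_nonneg_right hmain hP0.le
  rw [← hYP] at hfin
  refine hfin.trans (le_of_eq ?_)
  rw [hYP 0, Nat.add_sub_cancel, show 4 * (N + 1) + 2 = 4 * N + 6 by ring,
    show 8 * (N + 1) - 2 = 4 * N + (4 * N + 6) by omega, pow_add _ (4 * N) (4 * N + 6), ← hP, mul_pow, ← pow_mul]
  ring

/-- Growth of the Sobolev norms on the lattice with step one. -/
theorem IsFlow.exists_norm_diff_pow_le (n : ℕ) (hn : 1 ≤ n) :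
    ∃ C : ℝ, 0 < C ∧ ∀ (ν : ℝ), (ν = -1 ∨ ν = 1) → ∀ (u : ℝ → Seq), IsFlow ν u → ∀ t,
      ‖(diff ^ n) (u t)‖ ≤ C * (‖(diff ^ n) (u 0)‖
        + (‖diff (u 0)‖ + ‖u 0‖ ^ 3) ^ ((2 * (n : ℝ) + 1) / 3)
        + |t| ^ (((n : ℝ) - 1) / 2) * (‖diff (u 0)‖ + ‖u 0‖ ^ 3) ^ ((4 * (n : ℝ) - 1) / 3)) := by
  rcases Nat.lt_or_ge n 2 with h2 | h2
  · obtain rfl : n = 1 := by omega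
    refine ⟨2, by norm_num, fun ν hν u hu t => ?_⟩
    set M := ‖diff (u 0)‖ + ‖u 0‖ ^ 3 with hM
    have hM0 : 0 ≤ M := by positivity
    have h := hu.norm_diff_le_two_mul hν t
    have e1 : ((2 * ((1 : ℕ) : ℝ) + 1) / 3) = 1 := by norm_num
    rw [e1, Real.rpow_one, pow_one]
    have h3 : 0 ≤ |t| ^ ((((1 : ℕ) : ℝ) - 1) / 2) * M ^ ((4 * ((1 : ℕ) : ℝ) - 1) / 3) := by
      positivity
    rw [← hM] at h
    generalize |t| ^ ((((1 : ℕ) : ℝ) - 1) / 2) * M ^ ((4 * ((1 : ℕ) : ℝ) - 1) / 3) = z at h3 ⊢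
    linarith [norm_nonneg (diff (u 0))]
  · obtain ⟨C, hC, hbound⟩ := exists_norm_diff_pow_sq_le n h2
    refine ⟨Real.sqrt C * 2 ^ (4 * n), by positivity, fun ν hν u hu t => ?_⟩
    set M := ‖diff (u 0)‖ + ‖u 0‖ ^ 3 with hM
    have hM0 : 0 ≤ M := by positivity
    -- The scale `κ` must be positive; if `M = 0`, mass conservation makes the solution vanish.
    rcases hM0.eq_or_lt with hMz | hMpos
    · have hz : ‖u 0‖ = 0 := by
        have : ‖u 0‖ ^ 3 = 0 := by
          have h3 : 0 ≤ ‖u 0‖ ^ 3 := by positivity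
          linarith [norm_nonneg (diff (u 0))]
        exact pow_eq_zero_iff (by norm_num) |>.1 this
      have hut : u t = 0 := by
        rw [← norm_eq_zero, hu.norm_eq t, hz]
      rw [hut, map_zero, norm_zero]
      positivity
    -- The choice `κ³ = 2M` is exactly the a priori bound on `‖D u(t)‖`, and it also dominates `‖u
    -- 0‖³`.
    · set κ : ℝ := (2 * M) ^ (1 / 3 : ℝ) with hκ
      have hκ0 : 0 < κ := by positivity
      have hκj : ∀ j : ℕ, κ ^ j = (2 * M) ^ ((j : ℝ) / 3) := fun j => by
        rw [hκ, ← Real.rpow_natCast, ← Real.rpow_mul (by positivity)]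
        congr 1; ring
      have hκ3 : κ ^ 3 = 2 * M := by
        rw [hκj]; norm_num
      have hκle : ∀ j : ℕ, j ≤ 4 * n → κ ^ j ≤ 2 ^ (4 * n) * M ^ ((j : ℝ) / 3) := fun j hj => by
        rw [hκj, Real.mul_rpow (by norm_num) hM0]
        gcongr
        rw [← Real.rpow_natCast]
        refine Real.rpow_le_rpow_of_exponent_le (by norm_num) ?_
        have : (j : ℝ) ≤ (4 * n : ℕ) := by exact_mod_cast hj
        have hj0 : (0 : ℝ) ≤ j := by positivity
        linarith
      have hu0 : ‖u 0‖ ≤ κ := by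
        refine le_of_pow_le_pow_left₀ (by norm_num : 3 ≠ 0) hκ0.le ?_
        rw [hκ3]
        linarith [norm_nonneg (diff (u 0))]
      have h := hbound ν hν u hu κ hκ0 hu0 (by rw [hκ3]) t
      set s : ℝ := |t| ^ (((n : ℝ) - 1) / 2) with hs
      have hs2 : s ^ 2 = |t| ^ (n - 1) := by
        rw [hs, ← Real.rpow_natCast, ← Real.rpow_mul (abs_nonneg t), ← Real.rpow_natCast,
          Nat.cast_sub hn]
        congr 1; push_cast; ring
      have hs0 : 0 ≤ s := by positivity
      have hsq : ‖(diff ^ n) (u t)‖ ^ 2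
          ≤ (Real.sqrt C * (‖(diff ^ n) (u 0)‖ + κ ^ (2 * n + 1) + s * κ ^ (4 * n - 1))) ^ 2 := by
        refine h.trans ?_
        rw [mul_pow, Real.sq_sqrt hC.le, ← hs2]
        gcongr
        have e1 : κ ^ (4 * n + 2) = (κ ^ (2 * n + 1)) ^ 2 := by ring
        have e2 : κ ^ (8 * n - 2) = (κ ^ (4 * n - 1)) ^ 2 := by
          rw [← pow_mul]; congr 1; omega
        rw [e1, e2]
        have p1 : 0 ≤ ‖(diff ^ n) (u 0)‖ := norm_nonneg _
        have p2 : 0 ≤ κ ^ (2 * n + 1) := by positivity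
        have p3 : 0 ≤ s * κ ^ (4 * n - 1) := by positivity
        nlinarith [mul_nonneg p1 p2, mul_nonneg p1 p3, mul_nonneg p2 p3]
      have hle := (sq_le_sq₀ (norm_nonneg _) (by positivity)).1 hsq
      refine hle.trans ?_
      rw [mul_assoc]
      refine mul_le_mul_of_nonneg_left ?_ (Real.sqrt_nonneg C)
      have k1 := hκle (2 * n + 1) (by omega)
      have k2 := hκle (4 * n - 1) (by omega)
      rw [Nat.cast_sub (by omega)] at k2
      push_cast at k1 k2
      have k3 : ‖(diff ^ n) (u 0)‖ ≤ 2 ^ (4 * n) * ‖(diff ^ n) (u 0)‖ :=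
        le_mul_of_one_le_left (norm_nonneg _) (one_le_pow₀ (by norm_num))
      have k4 := mul_le_mul_of_nonneg_left k2 hs0
      calc _ ≤ 2 ^ (4 * n) * ‖(diff ^ n) (u 0)‖ + 2 ^ (4 * n) * M ^ ((2 * (n : ℝ) + 1) / 3)
            + s * (2 ^ (4 * n) * M ^ ((4 * (n : ℝ) - 1) / 3)) := by gcongr
        _ = _ := by ring

end DNLS

namespace DNLS

/-! ### Scaling from the grid `hℤ` to `ℤ`. -/

open scoped ComplexConjugate

/-- The enumeration `k ↦ k h` of the grid. -/
noncomputable def gridEquiv {h : ℝ} (hh : 0 < h) : ℤ ≃ Grid h :=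
  Equiv.ofBijective (fun k : ℤ => k • step h) <| by
    constructor
    · intro k l hkl
      have h1 : ((k • step h : Grid h) : ℝ) = ((l • step h : Grid h) : ℝ) := congrArg _ hkl
      simp only [step, AddSubgroup.coe_zsmul, zsmul_eq_mul] at h1
      exact_mod_cast mul_right_cancel₀ hh.ne' h1
    · rintro ⟨g, k, hk⟩
      exact ⟨k, Subtype.ext hk⟩

theorem gridEquiv_apply {h : ℝ} (hh : 0 < h) (k : ℤ) : gridEquiv hh k = k • step h := rfl

theorem gridEquiv_add_one {h : ℝ} (hh : 0 < h) (k : ℤ) :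
    gridEquiv hh (k + 1) = gridEquiv hh k + step h := by
  simp only [gridEquiv_apply, add_zsmul, one_zsmul]

theorem gridEquiv_sub_one {h : ℝ} (hh : 0 < h) (k : ℤ) :
    gridEquiv hh (k - 1) = gridEquiv hh k - step h := by
  rw [gridEquiv_apply, gridEquiv_apply, sub_zsmul, one_zsmul, sub_eq_add_neg]

theorem laplacian_gridEquiv {h : ℝ} (hh : 0 < h) {f : Grid h → ℂ} {b : Seq} {c : ℂ}
    (hf : ∀ k, f (gridEquiv hh k) = c * b k) (k : ℤ) :
    laplacian h f (gridEquiv hh k) = c / (h : ℂ) ^ 2 * lap b k := by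
  change (f (gridEquiv hh k + step h) - 2 * f (gridEquiv hh k) + f (gridEquiv hh k - step h))
    / (h : ℂ) ^ 2 = _
  rw [← gridEquiv_add_one, ← gridEquiv_sub_one, hf, hf, hf, lap_apply]
  ring

theorem neg_laplacian_pow_gridEquiv {h : ℝ} (hh : 0 < h) (a : L2 h) (n : ℕ) (k : ℤ) :
    ((-laplacian h) ^ n) (a : Grid h → ℂ) (gridEquiv hh k)
      = 1 / (h : ℂ) ^ (2 * n) * ((-lap) ^ n) (reindex (gridEquiv hh) a) k := by
  induction n generalizing k with
  | zero => simp
  | succ n ih =>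
    rw [pow_succ', pow_succ', Module.End.mul_apply, mul_apply_eq_comp]
    change -(laplacian h _ (gridEquiv hh k)) = _
    rw [laplacian_gridEquiv hh ih]
    change _ = _ * -(lap _ k)
    rw [mul_add, pow_add]
    field_simp

theorem pair_neg_lap_pow_left (n : ℕ) (a b : Seq) :
    pair (((-lap) ^ n) a) b = pair ((diff ^ n) a) ((diff ^ n) b) := by
  induction n generalizing a with
  | zero => simp
  | succ n ih =>
    have h1 : (-lap) a = -(lap a) := rfl
    rw [pow_succ, mul_apply_eq_comp, ih, h1, map_neg,
      ← apply_comm_of_commute (commute_lap_diff.pow_right n), pair_neg_left, pair_lap_left,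
      pair_lap_right, neg_neg, ← mul_apply_eq_comp, ← mul_apply_eq_comp, ← pow_succ']

theorem sobolevNorm_eq {h : ℝ} (hh : 0 < h) (n : ℕ) (a : L2 h) :
    sobolevNorm h n a
      = ‖(diff ^ n) ((h : ℂ) • reindex (gridEquiv hh) a)‖ / Real.sqrt h ^ (2 * n + 1) := by
  set w := reindex (gridEquiv hh) a with hw
  have hin : l2Inner h (((-laplacian h) ^ n) (a : Grid h → ℂ)) (a : Grid h → ℂ)
      = ((h / h ^ (2 * n) * ‖(diff ^ n) w‖ ^ 2 : ℝ) : ℂ) := by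
    have h1 : ∑' g : Grid h, ((-laplacian h) ^ n) (a : Grid h → ℂ) g * conj (a g)
        = 1 / (h : ℂ) ^ (2 * n) * pair (((-lap) ^ n) w) (star w) := by
      rw [← (gridEquiv hh).tsum_eq, pair, ← tsum_mul_left]
      congr 1; ext k
      rw [neg_laplacian_pow_gridEquiv, star_apply', hw, reindex_apply]
      ring
    rw [l2Inner, h1, pair_neg_lap_pow_left, diff_pow_star, pair_comm, pair_star_self]
    push_cast
    ring
  have hs : 0 < Real.sqrt h := Real.sqrt_pos.2 hh
  have hs2 : Real.sqrt h ^ 2 = h := Real.sq_sqrt hh.le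
  rw [sobolevNorm, hin, Complex.ofReal_re, map_smul, norm_smul, Complex.norm_of_nonneg hh.le]
  have e : h / h ^ (2 * n) * ‖(diff ^ n) w‖ ^ 2
      = (h * ‖(diff ^ n) w‖ / Real.sqrt h ^ (2 * n + 1)) ^ 2 := by
    rw [div_pow, ← pow_mul, mul_comm (2 * n + 1) 2, pow_mul (Real.sqrt h), hs2]
    field_simp
    ring
  rw [e, Real.sqrt_sq (by positivity)]

theorem l2Norm_eq {h : ℝ} (hh : 0 < h) (a : L2 h) :
    l2Norm h a = ‖(h : ℂ) • reindex (gridEquiv hh) a‖ / Real.sqrt h := by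
  have hs : 0 < Real.sqrt h := Real.sqrt_pos.2 hh
  rw [l2Norm, ← norm_sq_eq_tsum, Real.sqrt_mul hh.le, Real.sqrt_sq (norm_nonneg _), norm_smul,
    Complex.norm_of_nonneg hh.le, LinearIsometry.norm_map]
  rw [eq_div_iff hs.ne']
  linear_combination ‖a‖ * Real.mul_self_sqrt hh.le

theorem lowNorm_eq {h : ℝ} (hh : 0 < h) (a : L2 h) :
    lowNorm h a = (‖diff ((h : ℂ) • reindex (gridEquiv hh) a)‖
      + ‖(h : ℂ) • reindex (gridEquiv hh) a‖ ^ 3) / Real.sqrt h ^ 3 := by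
  rw [lowNorm, sobolevNorm_eq hh, l2Norm_eq hh, pow_one, div_pow, add_div]

theorem IsSolution.isFlow {h ν : ℝ} (hh : 0 < h) {u : ℝ → L2 h} (hu : IsSolution h ν u) :
    IsFlow ν fun τ => (h : ℂ) • reindex (gridEquiv hh) (u (h ^ 2 * τ)) := by
  intro τ
  have hd : HasDerivAt u (deriv u (h ^ 2 * τ)) (h ^ 2 * τ) :=
    (hu.contDiff.differentiable one_ne_zero).differentiableAt.hasDerivAt
  have hlin : HasDerivAt (fun τ : ℝ => h ^ 2 * τ) (h ^ 2) τ := by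
    simpa using (hasDerivAt_id τ).const_mul (h ^ 2)
  have h1 := hd.scomp τ hlin
  have h2 := (((reindex (gridEquiv hh)).toContinuousLinearMap.restrictScalars ℝ).hasFDerivAt
    ).comp_hasDerivAt τ h1
  refine (h2.const_smul (h : ℂ)).congr_deriv ?_
  ext k
  set g := gridEquiv hh k with hg
  -- Evaluation at a grid point is continuous on `ℓ²`, so the pointwise equation determines the `ℓ²`
  -- derivative.
  have heval : deriv (fun s : ℝ => (u s) g) (h ^ 2 * τ) = (deriv u (h ^ 2 * τ)) g :=
    ((((lp.evalCLM ℂ (fun _ : Grid h => ℂ) 2 g).restrictScalars ℝ).hasFDerivAt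
      ).comp_hasDerivAt _ hd).deriv
  have heq := hu.equation (h ^ 2 * τ) g
  rw [heval, laplacian_gridEquiv hh (b := reindex (gridEquiv hh) (u (h ^ 2 * τ))) (c := 1)
    (fun k => by simp)] at heq
  have hI : (deriv u (h ^ 2 * τ)) g = -Complex.I * (Complex.I * (deriv u (h ^ 2 * τ)) g) := by
    rw [← mul_assoc, neg_mul, Complex.I_mul_I]; ring
  have hL : (((h : ℂ) • ((reindex (gridEquiv hh)).toContinuousLinearMap.restrictScalars ℝ)
      (h ^ 2 • deriv u (h ^ 2 * τ)) : Seq) k) = (h : ℂ) ^ 3 * (deriv u (h ^ 2 * τ)) g := by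
    change (h : ℂ) * (((h ^ 2 : ℝ) : ℂ) * _) = _
    push_cast
    rw [← hg]; ring
  have hc : (h : ℂ) ≠ 0 := by exact_mod_cast hh.ne'
  rw [hL, hI, heq, map_smul]
  simp only [lp.coeFn_smul, Pi.smul_apply, lp.coeFn_add, Pi.add_apply, smul_eq_mul, cubic,
    mul_apply, star_apply', map_mul, Complex.conj_ofReal, reindex_apply, ← hg]
  have hn : ((‖(u (h ^ 2 * τ)) g‖ ^ 2 : ℝ) : ℂ)
      = (u (h ^ 2 * τ)) g * conj ((u (h ^ 2 * τ)) g) := by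
    rw [Complex.mul_conj, Complex.normSq_eq_norm_sq]
  rw [hn]
  field_simp

end DNLS

theorem theorem1 (n : ℕ) (hn : 1 ≤ n) :
    ∃ C : ℝ, 0 < C ∧
      ∀ (h : ℝ), 0 < h → ∀ (ν : ℝ), (ν = -1 ∨ ν = 1) →
        ∀ (u : ℝ → DNLS.L2 h), DNLS.IsSolution h ν u →
          ∀ t : ℝ,
            DNLS.sobolevNorm h n (u t) ≤
              C * (DNLS.sobolevNorm h n (u 0)
                + DNLS.lowNorm h (u 0) ^ ((2 * (n : ℝ) + 1) / 3)
                + |t| ^ (((n : ℝ) - 1) / 2)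
                  * DNLS.lowNorm h (u 0) ^ ((4 * (n : ℝ) - 1) / 3)) := by
  obtain ⟨C, hC, hbound⟩ := DNLS.IsFlow.exists_norm_diff_pow_le n hn
  refine ⟨C, hC, fun h hh ν hν u hu t => ?_⟩
  have hb := hbound ν hν _ (hu.isFlow hh) (t / h ^ 2)
  have ht : h ^ 2 * (t / h ^ 2) = t := by field_simp
  simp only [ht, mul_zero] at hb
  rw [DNLS.sobolevNorm_eq hh, DNLS.sobolevNorm_eq hh, DNLS.lowNorm_eq hh]
  set a := ‖(DNLS.diff ^ n) ((h : ℂ) • DNLS.reindex (DNLS.gridEquiv hh) (u 0))‖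
  set M := ‖DNLS.diff ((h : ℂ) • DNLS.reindex (DNLS.gridEquiv hh) (u 0))‖
      + ‖(h : ℂ) • DNLS.reindex (DNLS.gridEquiv hh) (u 0)‖ ^ 3
  have hM : 0 ≤ M := by positivity
  set r := Real.sqrt h with hr
  have hr0 : 0 < r := Real.sqrt_pos.2 hh
  have hr2 : r ^ 2 = h := Real.sq_sqrt hh.le
  have e1 : (M / r ^ 3) ^ ((2 * (n : ℝ) + 1) / 3) = M ^ ((2 * (n : ℝ) + 1) / 3) / r ^ (2 * n + 1) := by
    rw [Real.div_rpow hM (by positivity), ← Real.rpow_natCast r 3, ← Real.rpow_mul hr0.le,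
      ← Real.rpow_natCast r (2 * n + 1)]
    congr 2; push_cast; ring
  -- The exponent splits as `4n - 1 = (2n + 1) + 2(n - 1)`; the second part is compensated by the
  -- rescaling of time.
  have e2 : (M / r ^ 3) ^ ((4 * (n : ℝ) - 1) / 3)
      = M ^ ((4 * (n : ℝ) - 1) / 3) / (r ^ (2 * n + 1) * r ^ (2 * (n - 1))) := by
    rw [Real.div_rpow hM (by positivity), ← Real.rpow_natCast r 3, ← Real.rpow_mul hr0.le,
      ← pow_add, ← Real.rpow_natCast r (2 * n + 1 + 2 * (n - 1))]
    congr 2; push_cast [Nat.cast_sub hn]; ring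
  have e3 : |t / h ^ 2| ^ (((n : ℝ) - 1) / 2)
      = |t| ^ (((n : ℝ) - 1) / 2) / r ^ (2 * (n - 1)) := by
    rw [abs_div, ← hr2, abs_of_pos (by positivity : 0 < (r ^ 2) ^ 2),
      Real.div_rpow (abs_nonneg t) (by positivity), ← pow_mul, ← Real.rpow_natCast r (2 * 2),
      ← Real.rpow_mul hr0.le, ← Real.rpow_natCast r (2 * (n - 1))]
    congr 2; push_cast [Nat.cast_sub hn]; ring
  rw [e1, e2]
  rw [e3] at hb
  rw [div_le_iff₀ (by positivity)]
  refine hb.trans (le_of_eq ?_)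
  field_simp
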